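/- **Notation.** Operators act on $\mathbb C[x]$ or, where so indicated, on $\mathbb C[[y]]$. $x$ is multiplication by $x$, $\mathrm D=d/dx$. For a sequence $h$, $h_\theta$ is the operator $x^n\mapsto h_nx^n$ (and $y^n\mapsto h_ny^n$ on $\mathbb C[[y]]$); in particular $\theta!$ is $x^n\mapsto n!\,x^n$. For $\ell\in\mathbb C[[y]]$, $\ell(\mathrm D)=\sum_k\ell_k\mathrm D^k$. For $f\in y+y^2\mathbb C[[y]]$, $\mathrm C_f$ is the operator for which $p_n=\mathrm C_f\cdot x^n$ satisfies $e^{xy}=\sum_n p_n(x)f(y)^n/n!$, and $\mathfrak Tf=f/f'$. Complex powers of a power series with constant term $1$ are given by the binomial series. $(z)_n=z(z-1)\cdots(z-n+1)$ is the falling factorial. For an operator $\mathrm T$ on $\mathbb C[x]$, $\overline{\mathrm T}$ is the operator on $\mathbb C[[y]]$ with $\mathrm T\cdot e^{xy}=\overline{\mathrm T}\cdot e^{xy}$, i.e. $\overline{\mathrm T}\cdot\ell=\sum_k\frac{y^k}{k!}\,[\ell(\mathrm D)\mathrm T\cdot x^k]_{x=0}$. ${}_2F_1(p,q;s\,|\,z)$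 is the formal Gauss series. **Setting.** Let $a,\lambda,\kappa,\beta,r,c\in\mathbb C$ with $\lambda,\kappa\ne0$, $\frac1\kappa-\frac1\lambda=\frac12$, $\beta=r\kappa+(1-r)\lambda$. Let $f\in y+y^2\mathbb C[[y]]$ be the solution of $f'=(1+\tfrac12\lambda af)^2$, i.e. $f=y/(1-\tfrac12\lambda ay)$, and let $\omega$ be the functional inverse of $f/f'$. Put $$\rho(z)=\frac{1+\beta z}{(1+\lambda z)(1+\kappa z)},\qquad \frac{\mathcal F_{n+z}}{\mathcal F_z}=\prod_{j=0}^{n-1}\rho(z+j),\qquad \mathcal F_0=1,$$ $$A(z)=ra+(1-r)\left[\frac a2\,\frac{2+\lambda z}{1+\kappa z}+\frac a2\,\frac{\lambda z}{1+\kappa(z-1)}\right],$$ $$B(z)=\frac{\lambda a^2}4\,\frac{(2+\lambda(z-1))\bigl(r(1+\kappa(z-1))+(1-r)(1+\lambda z)\bigr)}{(1+\lambda z)(1+\kappa(z-1))}\,\rho(z-1).$$ (When $\kappa=1$, the last fraction in $A(0)$ is read as $0$.) Assume that for all integers $n\ge0$: $c+1+n\neq0$ and $1+\lambda(c+n)$,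 $1+\kappa(c+n)$, $1+\beta(c+n)$ are nonzero; and that either $c=0$ or both $1+\lambda(c-1)$ and $1+\kappa(c-1)$ are nonzero. Let $$k=f'(\omega)^{c-1+1/\lambda},\qquad H_n=(c+n-1)_n,$$ $$\mathrm G_{\mathcal J}(c)=\theta!\left(H_\theta\frac{\mathcal F_{\theta+c-1}}{\mathcal F_{c-1}}\cdot k\right)(\mathrm D)\,\frac{\mathcal F_c}{\mathcal F_{\theta+c}}\,(c+\theta)_\theta^{-1}\,\mathrm C_{\mathfrak Tf}^{-1}\,f'(\mathrm D)^{-c-1/\lambda}\,\mathrm C_f\,\frac{\mathcal F_{\theta+c}}{\mathcal F_c}\,\frac{(c+\theta)_\theta}{\theta!}$$ (for $c=0$, $H_\theta\frac{\mathcal F_{\theta+c-1}}{\mathcal F_{c-1}}\cdot k$ is the constant $1$). **Claim.** 1. (Jacobi family.) If $1+\lambda n,\,1+\kappa n,\,1+\beta n\ne0$ for all integers $n\ge0$, then $\mathrm G_{\mathcal J}=\mathcal F_\theta^{-1}\mathrm C_{\mathfrak Tf}^{-1}f'(\mathrm D)^{-1/\lambda}\mathrm C_f\mathcal F_\theta$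 is invertible and $\mathrm G_{\mathcal J}^{-1}\,x\,\mathrm G_{\mathcal J}=x+A(\theta)+\mathrm D\,B(\theta)$. 2. If $\beta\ne0$, then for every $n\ge0$ $$\frac{\mathcal F_{n+c}}{\mathcal F_c}=\left(\frac{4\beta}{\lambda\kappa}\right)^{n}\frac{\Gamma(2c+\frac2\lambda)}{\Gamma(2(n+c)+\frac2\lambda)}\,\frac{\Gamma(n+c+\frac1\beta)}{\Gamma(c+\frac1\beta)}.$$ 3. (Associated Jacobi polynomials.) $\mathrm G_{\mathcal J}(c)$ is invertible and $$\mathrm G_{\mathcal J}(c)^{-1}\,x\,\mathrm G_{\mathcal J}(c)=x+A(\theta+c)+\frac{(1+c+\theta)\,B(\theta+c+1)}{1+\theta}\,\mathrm D.$$ The polynomials $p_n(x,c)=\mathrm G_{\mathcal J}(c)\cdot x^n$ are monic of degree $n$ and are the associated Jacobi polynomials: $p_0=1$, $p_1=x-A(c)$, and $p_{n+1}=(x-A(n+c))\,p_n-(n+c)B(n+c)\,p_{n-1}$ for $n\ge1$. With $f_0(y,c)=\overline{\mathrm G_{\mathcal J}(c)^{-1}}\cdot1$ and $\langle p,q\rangle=f_0(\mathrm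 D,c)\,pq\,|_{x=0}$ they satisfy $\langle p_m,p_n\rangle=0$ for $m\ne n$ and $\langle p_n,p_n\rangle=\prod_{j=1}^n(j+c)B(j+c)$. 4. (Moment generating function.) The formal Laplace transform $F_0^{\mathcal J}(y,c)=\theta!\cdot f_0(y,c)$ satisfies $$F_0^{\mathcal J}(y,c)=\frac{(c+\theta)_\theta\frac{\mathcal F_{\theta+c}}{\mathcal F_c}\cdot f'(\omega(y))^{c+1/\lambda}}{(c-1+\theta)_\theta\frac{\mathcal F_{\theta+c-1}}{\mathcal F_{c-1}}\cdot f'(\omega(y))^{c-1+1/\lambda}},$$ and, if $\beta\neq0$, this equals $$\frac{{}_2F_1\!\left(c+1,\;c+\frac1\beta;\;2c+\frac2\kappa\;\Big|\;\frac{2\beta ay}{\kappa}\right)}{{}_2F_1\!\left(c,\;c-1+\frac1\beta;\;2c-2+\frac2\kappa\;\Big|\;\frac{2\beta ay}{\kappa}\right)}$$ (for $c=0$ the denominator is $1$). -/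

import Mathlib

noncomputable section

namespace Umbral

/-! ### Linear operators on `ℂ[x]` -/

/-- The linear operator on `ℂ[x]` that sends `x ^ n` to `v n`. -/
def opOf (v : ℕ → Polynomial ℂ) : Module.End ℂ (Polynomial ℂ) :=
  (Polynomial.basisMonomials ℂ).constr ℂ v

theorem opOf_X_pow (v : ℕ → Polynomial ℂ) (n : ℕ) :
    opOf v (Polynomial.X ^ n) = v n := by
  have h : (Polynomial.X ^ n : Polynomial ℂ) = Polynomial.basisMonomials ℂ n := by
    simp [Polynomial.coe_basisMonomials, Polynomial.X_pow_eq_monomial]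
  rw [h, opOf, Module.Basis.constr_basis]

/-- Multiplication by `x`. -/
def mulX : Module.End ℂ (Polynomial ℂ) := LinearMap.mulLeft ℂ (Polynomial.X : Polynomial ℂ)

/-- The derivative `D = d/dx`. -/
def opD : Module.End ℂ (Polynomial ℂ) := Polynomial.derivative

/-- The diagonal operator `h_θ : x ^ n ↦ h n * x ^ n`. -/
def diag (h : ℕ → ℂ) : Module.End ℂ (Polynomial ℂ) :=
  opOf fun n => Polynomial.C (h n) * Polynomial.X ^ n

/-- `ℓ(D) = ∑ k, ℓ_k D ^ k` for a formal power series `ℓ`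
(on `x ^ n` the terms with `k > n` vanish). -/
def seriesD (l : PowerSeries ℂ) : Module.End ℂ (Polynomial ℂ) :=
  opOf fun n => ∑ k ∈ Finset.range (n + 1),
    PowerSeries.coeff k l • Polynomial.derivative^[k] (Polynomial.X ^ n)

/-! ### Formal power series -/

/-- The diagonal operator `h_θ : y ^ n ↦ h n * y ^ n` on power series. -/
def diagSeries (h : ℕ → ℂ) (l : PowerSeries ℂ) : PowerSeries ℂ :=
  PowerSeries.mk fun n => h n * PowerSeries.coeff n l

/-- The power `u ^ s = ∑ k, (s choose k) (u - 1) ^ k` with complex exponent `s`, of a power series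
`u` whose constant coefficient is `1`. -/
def cpow (u : PowerSeries ℂ) (s : ℂ) : PowerSeries ℂ :=
  (PowerSeries.binomialSeries ℂ s).subst (u - 1)

open Classical in
/-- The functional inverse of a power series `f = f₁ y + f₂ y ^ 2 + ...` with `f₁ ≠ 0`. -/
def compInv (f : PowerSeries ℂ) : PowerSeries ℂ :=
  if h : IsUnit (PowerSeries.coeff 1 f) then PowerSeries.substInvOfIsUnit f h else 0

/-- The formal derivative of a power series. -/
def derivS (f : PowerSeries ℂ) : PowerSeries ℂ := PowerSeries.derivative ℂ f

/-- `𝔗f = f / f'`. -/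
def frakT (f : PowerSeries ℂ) : PowerSeries ℂ := f * (derivS f)⁻¹

/-- The formal Gauss series `₂F₁(p, q; s | y)`. -/
def hyp2F1 (p q s : ℂ) : PowerSeries ℂ :=
  PowerSeries.mk (ordinaryHypergeometricCoefficient p q s)

/-! ### Umbral operators -/

/-- The operator determined by `e ^ (x y) ↦ e ^ (x g(y))`, that is
`x ^ n ↦ n! [y ^ n] e ^ (x g(y)) = ∑ k, (n! / k!) ([y ^ n] g ^ k) x ^ k`, where `g(0) = 0`. -/
def expSubst (g : PowerSeries ℂ) : Module.End ℂ (Polynomial ℂ) :=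
  opOf fun n => ∑ k ∈ Finset.range (n + 1),
    Polynomial.C ((n.factorial : ℂ) / (k.factorial : ℂ) * PowerSeries.coeff n (g ^ k)) *
      Polynomial.X ^ k

/-- The umbral operator `C_f`, `f = y + O(y ^ 2)`, whose values `p_n = C_f x ^ n` form the family of
binomial type with `e ^ (x y) = ∑ n, p_n(x) f(y) ^ n / n!`. Equivalently
`C_f e ^ (x y) = e ^ (x φ(y))` for the functional inverse `φ` of `f`. -/
def umbralC (f : PowerSeries ℂ) : Module.End ℂ (Polynomial ℂ) := expSubst (compInv f)

/-- The operator `T̄` on `ℂ[[y]]` with `T e ^ (x y) = T̄ e ^ (x y)`: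
`T̄ ℓ = ∑ k, (y ^ k / k!) [ℓ(D) T x ^ k]` at `x = 0`. -/
def bar (T : Module.End ℂ (Polynomial ℂ)) (l : PowerSeries ℂ) : PowerSeries ℂ :=
  PowerSeries.mk fun k => (seriesD l (T (Polynomial.X ^ k))).eval 0 / (k.factorial : ℂ)

/-- The moment generating function `f₀ = (G⁻¹)‾ 1` of the family `G x ^ n`. -/
def momentSeries (G : Module.End ℂ (Polynomial ℂ)) : PowerSeries ℂ := bar (Ring.inverse G) 1

/-- The bilinear form `⟨p, q⟩ = f₀(D) (p q)` at `x = 0`. -/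
def pairing (f₀ : PowerSeries ℂ) (p q : Polynomial ℂ) : ℂ := (seriesD f₀ (p * q)).eval 0

/-- The falling factorial `(z)_n = z (z - 1) ⋯ (z - n + 1)`. -/
def fall (z : ℂ) (n : ℕ) : ℂ := ∏ j ∈ Finset.range n, (z - (j : ℂ))

/-! ### Associated families -/

/-- The associated dual raising operator `x + A_{θ+c} + ((1 + c + θ) B_{θ+c+1} / (1 + θ)) D` of a
family with dual raising operator `x + A_θ + D B_θ`. -/
def assocDualRaising (A B : ℂ → ℂ) (c : ℂ) : Module.End ℂ (Polynomial ℂ) :=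
  mulX + diag (fun n => A (n + c)) + diag (fun n => (1 + c + n) * B (n + c + 1) / (1 + n)) * opD

/-- The associated monic polynomials `p_n(x, c)` of a family with recurrence
`x p_n = p_{n+1} + A_n p_n + n B_n p_{n-1}`. -/
def assocPoly (A B : ℂ → ℂ) (c : ℂ) : ℕ → Polynomial ℂ
  | 0 => 1
  | 1 => Polynomial.X - Polynomial.C (A c)
  | n + 2 => (Polynomial.X - Polynomial.C (A (n + 1 + c))) * assocPoly A B c (n + 1) -
      Polynomial.C ((n + 1 + c) * B (n + 1 + c)) * assocPoly A B c n

/-! ### The Jacobi family -/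

/-- The series `f = y / (1 - λ a y / 2)`, the solution of `f' = (1 + λ a f / 2) ^ 2`, `f(0) = 0`. -/
def jacobif (a lam : ℂ) : PowerSeries ℂ :=
  PowerSeries.X * (1 - PowerSeries.C (lam * a / 2) * PowerSeries.X)⁻¹

theorem constantCoeff_jacobif (a lam : ℂ) : PowerSeries.constantCoeff (jacobif a lam) = 0 := by
  simp [jacobif]

theorem deriv_jacobif (a lam : ℂ) :
    derivS (jacobif a lam) = (1 + PowerSeries.C (lam * a / 2) * jacobif a lam) ^ 2 := by
  set t : ℂ := lam * a / 2
  have hu : (1 - PowerSeries.C t * PowerSeries.X) * (1 - PowerSeries.C t * PowerSeries.X)⁻¹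
      = (1 : PowerSeries ℂ) := by
    apply PowerSeries.mul_inv_cancel
    simp
  have hd := congrArg (PowerSeries.derivative ℂ) hu
  simp only [jacobif, derivS]
  set u : PowerSeries ℂ := 1 - PowerSeries.C t * PowerSeries.X with hu'
  have hdu : PowerSeries.derivative ℂ u = - PowerSeries.C t := by
    simp [hu', Derivation.leibniz]
  simp only [Derivation.leibniz, smul_eq_mul, hdu, Derivation.map_one_eq_zero] at hd
  simp only [Derivation.leibniz, smul_eq_mul, PowerSeries.derivative_X]
  have hX : PowerSeries.C t * PowerSeries.X = 1 - u := by simp [hu']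
  have h1 : 1 + PowerSeries.C t * (PowerSeries.X * u⁻¹) = u⁻¹ := by
    rw [← mul_assoc, hX]; linear_combination (-1 : PowerSeries ℂ) * hu
  rw [h1]
  linear_combination (-(PowerSeries.X * PowerSeries.derivative ℂ u⁻¹) + u⁻¹ ^ 2 - u⁻¹) * hu
    + u⁻¹ * PowerSeries.X * hd + (u⁻¹ ^ 2) * hX
    + u⁻¹ ^ 3 * hX - u⁻¹ ^ 2 * hu

/-- `ω = (f / f')^{inv}`. -/
def jacobiOmega (a lam : ℂ) : PowerSeries ℂ := compInv (frakT (jacobif a lam))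

/-- `f'(ω(y))`. -/
def jacobiW (a lam : ℂ) : PowerSeries ℂ :=
  (derivS (jacobif a lam)).subst (jacobiOmega a lam)

/-- `(1 + β z) / ((1 + λ z) (1 + κ z))`. -/
def jacobiRatio (lam kap bet z : ℂ) : ℂ := (1 + bet * z) / ((1 + lam * z) * (1 + kap * z))

/-- `ℱ_{n+z} / ℱ_z` for a sequence with `ℱ_{z+1} / ℱ_z = (1 + β z) / ((1 + λ z) (1 + κ z))`. -/
def jacobiF (lam kap bet z : ℂ) (n : ℕ) : ℂ :=
  ∏ j ∈ Finset.range n, jacobiRatio lam kap bet (z + j)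

/-- The operator `ℱ_θ⁻¹ C_{𝔗f}⁻¹ f'(D)^{-1/λ} C_f ℱ_θ` of the Jacobi family, `ℱ_0 = 1`. -/
def jacobiG (a lam kap bet : ℂ) : Module.End ℂ (Polynomial ℂ) :=
  diag (fun n => (jacobiF lam kap bet 0 n)⁻¹) *
    Ring.inverse (umbralC (frakT (jacobif a lam))) *
    seriesD (cpow (derivS (jacobif a lam)) (-(1 / lam))) *
    umbralC (jacobif a lam) *
    diag (jacobiF lam kap bet 0)

/-- The coefficient `A_z` of the Jacobi three-term relation, a rational function of the index.
(Where it is used, the last denominator vanishes only for `z = 0`, `κ = 1`; that summand, which has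
the numerator `0`, is then `0`.) -/
def jacobiA (a lam kap r z : ℂ) : ℂ :=
  r * a + (1 - r) * (a / 2 * (2 + lam * z) / (1 + kap * z) +
    a / 2 * (lam * z) / (1 + kap * (z - 1)))

/-- The coefficient `B_z` of the Jacobi three-term relation, a rational function of the index. -/
def jacobiB (a lam kap bet r z : ℂ) : ℂ :=
  lam * a ^ 2 / 4 * ((2 + lam * (z - 1)) * (r * (1 + kap * (z - 1)) + (1 - r) * (1 + lam * z))) /
    ((1 + lam * z) * (1 + kap * (z - 1))) * jacobiRatio lam kap bet (z - 1)

/-- The series `H_θ (ℱ_{θ+c-1} / ℱ_{c-1}) k` with `H_n = (c + n - 1)_n` and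
`k = f'(ω)^{c-1+1/λ}`. -/
def jacobiK (a lam kap bet c : ℂ) : PowerSeries ℂ :=
  diagSeries (fun n => fall (c + n - 1) n * jacobiF lam kap bet (c - 1) n)
    (cpow (jacobiW a lam) (c - 1 + 1 / lam))

/-- The series `(c + θ)_θ (ℱ_{θ+c} / ℱ_c) f'(ω)^{c+1/λ}`. -/
def jacobiN (a lam kap bet c : ℂ) : PowerSeries ℂ :=
  diagSeries (fun n => fall (c + n) n * jacobiF lam kap bet c n)
    (cpow (jacobiW a lam) (c + 1 / lam))

/-- The explicit operator
`θ! (H_θ (ℱ_{θ+c-1} / ℱ_{c-1}) k)(D) (ℱ_c / ℱ_{θ+c}) (c + θ)_θ⁻¹ C_{𝔗f}⁻¹ f'(D)^{-c-1/λ} C_f`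
`(ℱ_{θ+c} / ℱ_c) ((c + θ)_θ / θ!)`. -/
def assocJacobiG (a lam kap bet c : ℂ) : Module.End ℂ (Polynomial ℂ) :=
  diag (fun n => (n.factorial : ℂ)) *
    seriesD (jacobiK a lam kap bet c) *
    diag (fun n => (jacobiF lam kap bet c n)⁻¹) *
    diag (fun n => (fall (c + n) n)⁻¹) *
    Ring.inverse (umbralC (frakT (jacobif a lam))) *
    seriesD (cpow (derivS (jacobif a lam)) (-c - 1 / lam)) *
    umbralC (jacobif a lam) *
    diag (jacobiF lam kap bet c) *
    diag (fun n => fall (c + n) n / (n.factorial : ℂ))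

end Umbral

end

open Umbral

namespace Umbral

/-! ### Coefficients of operators -/

/-! The proof turns every operator into an explicit triangular matrix. A Sheffer operator sends `e ^
(x y)` to `l(y) e ^ (x g(y))`, and such operators compose by substitution (`sheffer_mul`). With `φ`
the inverse of `f` and `U = 1 + λ a y / 2`, the equation for `f` gives `f'(φ) = U ^ 2` and `(f /
f')(φ) = V = y / U ^ 2`. Hence the core `C_{𝔗f}⁻¹ f'(D)^{-u-1/λ} C_f` is the Sheffer operator with
`l = U ^ (-2u - 2/λ)` and `g = V`, and its entries are single binomial coefficients in `k + u` and
`n - k` (`coeff_jacobiCore`).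

Conjugating with the weights `w_n = (c + n)_n ℱ_{n+c} / ℱ_c` gives a unitriangular matrix, the
Jacobi matrix with both indices shifted by `c`. The three-term relation for its rows is a rational
identity in `k + c` and `n - k`, so it survives the shift (`jacobiEntry_step`,
`jacobiEntry_step_diag`), except at the edge: in column `0` it asks for an entry in column `-1`,
which the shifted matrix does not have. The rows therefore satisfy the recurrence up to a constant,
`jacobiBoundary`.

The left factor of the operator removes this defect. Moving `θ!` across `K(D)` yields `K(Δ)`, where
`Δ p = (p - p(0)) / x`, and `K(Δ)` commutes with `x` up to a constant (`seriesShift_X_mul`). For the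
given `K` that constant cancels the defect (`seriesShift_boundary`): since `f'(ω)` composed with `V`
is `U ^ 2`, the coefficients of powers of `f'(ω)` invert the binomial matrix
(`sum_coeff_cpow_jacobiW` with `u = c - 1`). Monicity, invertibility and orthogonality then follow
from the recurrence.

The same summation with `u = c` identifies the moment functional composed with `K(Δ)` as `x ^ n ↦ [y
^ n] N`, which says that `F₀ K = N`. Finally, the coefficients of `f'(ω) ^ (u + 1/λ)` are ballot
numbers (`coeff_cpow_jacobiW`); multiplied by the `ℱ` quotients they become ratios of Pochhammer
products, because `2/κ = 2/λ + 1`. The Jacobi family itself is the case `c = 0`, where `K = 1`. -/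

theorem end_ext {S T : Module.End ℂ (Polynomial ℂ)}
    (h : ∀ n : ℕ, S (Polynomial.X ^ n) = T (Polynomial.X ^ n)) : S = T := by
  refine (Polynomial.basisMonomials ℂ).ext fun n => ?_
  simpa [Polynomial.coe_basisMonomials, Polynomial.X_pow_eq_monomial] using h n

theorem apply_sum_X_pow (T : Module.End ℂ (Polynomial ℂ)) (s : Finset ℕ) (a : ℕ → ℂ) :
    T (∑ k ∈ s, Polynomial.C (a k) * Polynomial.X ^ k) =
      ∑ k ∈ s, a k • T (Polynomial.X ^ k) := by
  rw [map_sum]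
  exact Finset.sum_congr rfl fun k _ => by rw [← Polynomial.smul_eq_C_mul, map_smul]

theorem diag_X_pow (h : ℕ → ℂ) (n : ℕ) :
    diag h (Polynomial.X ^ n) = h n • Polynomial.X ^ n := by
  rw [diag, opOf_X_pow, Polynomial.smul_eq_C_mul]

theorem coeff_diag (h : ℕ → ℂ) (p : Polynomial ℂ) (k : ℕ) :
    (diag h p).coeff k = h k * p.coeff k := by
  conv_lhs => rw [p.as_sum_range_C_mul_X_pow]
  rw [apply_sum_X_pow, Polynomial.finsetSum_coeff]
  simp only [diag_X_pow, Polynomial.coeff_smul, Polynomial.coeff_X_pow, smul_eq_mul, mul_ite,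
    mul_one, mul_zero, Finset.sum_ite_eq, Finset.mem_range]
  split_ifs with hk
  · ring
  · rw [Polynomial.coeff_eq_zero_of_natDegree_lt (by omega), mul_zero]

theorem coeff_sum_C_mul_X_pow (a : ℕ → ℂ) (N k : ℕ) :
    (∑ j ∈ Finset.range N, Polynomial.C (a j) * Polynomial.X ^ j).coeff k =
      if k < N then a k else 0 := by
  simp [Polynomial.finsetSum_coeff, Polynomial.coeff_X_pow]

/-! ### Substitution of power series -/

theorem hasSubst_of_constantCoeff {g : PowerSeries ℂ} (hg : PowerSeries.constantCoeff g = 0) :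
    PowerSeries.HasSubst g :=
  PowerSeries.HasSubst.of_constantCoeff_zero hg

theorem coeff_mul_pow_of_lt {g : PowerSeries ℂ} (hg : PowerSeries.constantCoeff g = 0)
    (l : PowerSeries ℂ) {n k : ℕ} (h : n < k) : PowerSeries.coeff n (l * g ^ k) = 0 := by
  obtain ⟨v, rfl⟩ := PowerSeries.X_dvd_iff.2 hg
  rw [mul_pow, mul_left_comm, PowerSeries.coeff_X_pow_mul', if_neg (by omega)]

theorem coeff_subst_eq_sum {g : PowerSeries ℂ} (hg : PowerSeries.constantCoeff g = 0)
    (h : PowerSeries ℂ) {n N : ℕ} (hN : n < N) :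
    PowerSeries.coeff n (h.subst g) =
      ∑ j ∈ Finset.range N, PowerSeries.coeff j h * PowerSeries.coeff n (g ^ j) := by
  rw [PowerSeries.coeff_subst' (hasSubst_of_constantCoeff hg)]
  simp only [smul_eq_mul]
  refine finsum_eq_sum_of_support_subset _ fun j hj => ?_
  by_contra hj'
  have hlt : n < j := by simp at hj'; omega
  refine hj ?_
  have := coeff_mul_pow_of_lt hg 1 hlt
  rw [one_mul] at this
  simp only [this, mul_zero]

theorem coeff_mul_subst {g : PowerSeries ℂ} (hg : PowerSeries.constantCoeff g = 0)
    (l h : PowerSeries ℂ) (n : ℕ) :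
    PowerSeries.coeff n (l * h.subst g) =
      ∑ j ∈ Finset.range (n + 1), PowerSeries.coeff j h * PowerSeries.coeff n (l * g ^ j) := by
  simp only [PowerSeries.coeff_mul, Finset.mul_sum]
  rw [Finset.sum_comm]
  refine Finset.sum_congr rfl fun p hp => ?_
  have hp' := Finset.HasAntidiagonal.mem_antidiagonal.1 hp
  rw [coeff_subst_eq_sum hg h (show p.2 < n + 1 by omega), Finset.mul_sum]
  exact Finset.sum_congr rfl fun j _ => by ring

theorem constantCoeff_subst_of_zero {g : PowerSeries ℂ} (hg : PowerSeries.constantCoeff g = 0)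
    (h : PowerSeries ℂ) :
    PowerSeries.constantCoeff (h.subst g) = PowerSeries.constantCoeff h := by
  have := coeff_subst_eq_sum hg h (n := 0) (N := 1) (by omega)
  simpa using this

theorem subst_one {g : PowerSeries ℂ} (hg : PowerSeries.constantCoeff g = 0) :
    (1 : PowerSeries ℂ).subst g = (1 : PowerSeries ℂ) := by
  rw [← PowerSeries.coe_substAlgHom (hasSubst_of_constantCoeff hg), map_one]

theorem subst_C' {g : PowerSeries ℂ} (hg : PowerSeries.constantCoeff g = 0) (z : ℂ) :
    (PowerSeries.C z).subst g = (PowerSeries.C z : PowerSeries ℂ) := by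
  rw [← PowerSeries.coe_substAlgHom (hasSubst_of_constantCoeff hg)]
  exact AlgHom.commutes _ z

/-! ### Sheffer operators -/

/-- The operator with `e ^ (x y) ↦ l(y) e ^ (x g(y))`, where `g(0) = 0`. -/
noncomputable def sheffer (l g : PowerSeries ℂ) : Module.End ℂ (Polynomial ℂ) :=
  opOf fun n => ∑ k ∈ Finset.range (n + 1),
    Polynomial.C ((n.factorial : ℂ) / (k.factorial : ℂ) * PowerSeries.coeff n (l * g ^ k)) *
      Polynomial.X ^ k

theorem coeff_sheffer {g : PowerSeries ℂ} (hg : PowerSeries.constantCoeff g = 0)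
    (l : PowerSeries ℂ) (n k : ℕ) :
    (sheffer l g (Polynomial.X ^ n)).coeff k =
      (n.factorial : ℂ) / (k.factorial : ℂ) * PowerSeries.coeff n (l * g ^ k) := by
  rw [sheffer, opOf_X_pow, coeff_sum_C_mul_X_pow]
  split_ifs with h
  · rfl
  · rw [coeff_mul_pow_of_lt hg l (by omega), mul_zero]

/-- The right factor produces `l₂(y) e ^ (x g₂(y))`; the left factor acts on `x` only, so it sees `e
^ (x z)` at `z = g₂(y)`. -/
theorem sheffer_mul {g₁ g₂ : PowerSeries ℂ} (hg₁ : PowerSeries.constantCoeff g₁ = 0)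
    (hg₂ : PowerSeries.constantCoeff g₂ = 0) (l₁ l₂ : PowerSeries ℂ) :
    sheffer l₁ g₁ * sheffer l₂ g₂ = sheffer (l₂ * l₁.subst g₂) (g₁.subst g₂) := by
  have hs := hasSubst_of_constantCoeff hg₂
  refine end_ext fun n => Polynomial.ext fun k => ?_
  rw [coeff_sheffer (by rw [constantCoeff_subst_of_zero hg₂, hg₁]), mul_assoc,
    ← PowerSeries.subst_pow hs, ← PowerSeries.subst_mul hs, coeff_mul_subst hg₂,
    Module.End.mul_apply, sheffer.eq_def l₂ g₂, opOf_X_pow, apply_sum_X_pow,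
    Polynomial.finsetSum_coeff, Finset.mul_sum]
  refine Finset.sum_congr rfl fun j _ => ?_
  rw [Polynomial.coeff_smul, coeff_sheffer hg₁, smul_eq_mul]
  have : (j.factorial : ℂ) ≠ 0 := by exact_mod_cast j.factorial_ne_zero
  field_simp

theorem sheffer_one_X : sheffer 1 PowerSeries.X = 1 := by
  refine end_ext fun n => Polynomial.ext fun k => ?_
  rw [coeff_sheffer (by simp), one_mul, PowerSeries.coeff_X_pow, Module.End.one_apply,
    Polynomial.coeff_X_pow]
  by_cases h : n = k
  · subst h
    have : (n.factorial : ℂ) ≠ 0 := by exact_mod_cast n.factorial_ne_zero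
    simp [this]
  · simp [h, Ne.symm h]

theorem expSubst_eq_sheffer (g : PowerSeries ℂ) : expSubst g = sheffer 1 g := by
  simp only [expSubst, sheffer, one_mul]

theorem coeff_seriesD (l : PowerSeries ℂ) (n k : ℕ) :
    (seriesD l (Polynomial.X ^ n)).coeff k =
      if k ≤ n then (n.factorial : ℂ) / (k.factorial : ℂ) * PowerSeries.coeff (n - k) l else 0 := by
  rw [seriesD, opOf_X_pow, Polynomial.finsetSum_coeff]
  simp only [Polynomial.coeff_smul, Polynomial.iterate_derivative_X_pow_eq_smul, smul_eq_mul,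
    Polynomial.coeff_X_pow, mul_ite, mul_one, mul_zero]
  split_ifs with hk
  · rw [Finset.sum_eq_single (n - k)]
    · rw [if_pos (by omega)]
      have h := Nat.factorial_mul_descFactorial (show n - k ≤ n by omega)
      rw [show n - (n - k) = k by omega] at h
      have hk0 : (k.factorial : ℂ) ≠ 0 := by exact_mod_cast k.factorial_ne_zero
      rw [← h]
      push_cast
      field_simp
    · intro j hj hne
      simp at hj
      rw [if_neg (by omega)]
    · intro h
      simp at h
  · refine Finset.sum_eq_zero fun j hj => ?_
    simp at hj
    rw [if_neg (by omega)]

theorem seriesD_eq_sheffer (l : PowerSeries ℂ) : seriesD l = sheffer l PowerSeries.X := by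
  refine end_ext fun n => Polynomial.ext fun k => ?_
  rw [coeff_seriesD, coeff_sheffer (by simp), PowerSeries.coeff_mul_X_pow']
  split_ifs <;> simp

/-! ### Functional inverses -/

theorem constantCoeff_compInv (g : PowerSeries ℂ) :
    PowerSeries.constantCoeff (compInv g) = 0 := by
  rw [compInv]
  split_ifs <;> simp

theorem subst_compInv {g : PowerSeries ℂ} (hg : PowerSeries.constantCoeff g = 0)
    (hg₁ : PowerSeries.coeff 1 g ≠ 0) : g.subst (compInv g) = PowerSeries.X := by
  rw [compInv, dif_pos (isUnit_iff_ne_zero.2 hg₁)]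
  exact PowerSeries.subst_substInvOfIsUnit_right _ hg _

theorem compInv_subst {g : PowerSeries ℂ} (hg : PowerSeries.constantCoeff g = 0)
    (hg₁ : PowerSeries.coeff 1 g ≠ 0) : (compInv g).subst g = PowerSeries.X := by
  rw [compInv, dif_pos (isUnit_iff_ne_zero.2 hg₁)]
  exact PowerSeries.subst_substInvOfIsUnit_left _ hg _

/-- `C_g` substitutes the functional inverse of `g` in the exponent, so its inverse substitutes `g`
itself and no inversion remains. -/
theorem inverse_umbralC {g : PowerSeries ℂ} (hg : PowerSeries.constantCoeff g = 0)
    (hg₁ : PowerSeries.coeff 1 g ≠ 0) : Ring.inverse (umbralC g) = sheffer 1 g := by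
  rw [umbralC, expSubst_eq_sheffer]
  have h₁ : sheffer 1 (compInv g) * sheffer 1 g = 1 := by
    rw [sheffer_mul (constantCoeff_compInv g) hg, subst_one hg, compInv_subst hg hg₁, one_mul,
      sheffer_one_X]
  have h₂ : sheffer 1 g * sheffer 1 (compInv g) = 1 := by
    rw [sheffer_mul hg (constantCoeff_compInv g), subst_one (constantCoeff_compInv g),
      subst_compInv hg hg₁, one_mul, sheffer_one_X]
  exact Ring.inverse_unit ⟨_, _, h₁, h₂⟩

/-! ### Complex powers -/

theorem constantCoeff_sub_one {u : PowerSeries ℂ} (hu : PowerSeries.constantCoeff u = 1) :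
    PowerSeries.constantCoeff (u - 1) = 0 := by
  simp [hu]

theorem constantCoeff_cpow {u : PowerSeries ℂ} (hu : PowerSeries.constantCoeff u = 1) (s : ℂ) :
    PowerSeries.constantCoeff (cpow u s) = 1 := by
  rw [cpow, constantCoeff_subst_of_zero (constantCoeff_sub_one hu),
    PowerSeries.binomialSeries_constantCoeff]

theorem cpow_add {u : PowerSeries ℂ} (hu : PowerSeries.constantCoeff u = 1) (s t : ℂ) :
    cpow u (s + t) = cpow u s * cpow u t := by
  rw [cpow, PowerSeries.binomialSeries_add,
    PowerSeries.subst_mul (hasSubst_of_constantCoeff (constantCoeff_sub_one hu)), cpow, cpow]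

theorem cpow_natCast {u : PowerSeries ℂ} (hu : PowerSeries.constantCoeff u = 1) (n : ℕ) :
    cpow u n = u ^ n := by
  have h := hasSubst_of_constantCoeff (constantCoeff_sub_one hu)
  rw [cpow, PowerSeries.binomialSeries_nat, PowerSeries.subst_pow h, PowerSeries.subst_add h,
    subst_one (constantCoeff_sub_one hu), PowerSeries.subst_X h, add_sub_cancel]

theorem cpow_zero {u : PowerSeries ℂ} (hu : PowerSeries.constantCoeff u = 1) :
    cpow u 0 = 1 := by
  simpa using cpow_natCast hu 0

theorem cpow_nsmul {u : PowerSeries ℂ} (hu : PowerSeries.constantCoeff u = 1) (s : ℂ) (n : ℕ) :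
    cpow u (n * s) = cpow u s ^ n := by
  induction n with
  | zero => simp [cpow_zero hu]
  | succ n ih => rw [pow_succ, ← ih, ← cpow_add hu]; push_cast; ring_nf

theorem cpow_subst {u g : PowerSeries ℂ} (hu : PowerSeries.constantCoeff u = 1)
    (hg : PowerSeries.constantCoeff g = 0) (s : ℂ) :
    (cpow u s).subst g = cpow (u.subst g) s := by
  have h := hasSubst_of_constantCoeff (constantCoeff_sub_one hu)
  have h' := hasSubst_of_constantCoeff hg
  rw [cpow, PowerSeries.subst_comp_subst_apply h h', PowerSeries.subst_sub h', subst_one hg, cpow]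

theorem choose_succ_mul (s : ℂ) (n : ℕ) :
    Ring.choose s (n + 1) * (n + 1) = (s - n) * Ring.choose s n := by
  have h := Ring.choose_smul_choose s (n := n + 1) (k := n) (Nat.le_succ n)
  rw [Nat.choose_succ_self_right, add_tsub_cancel_left, Ring.choose_one_right, nsmul_eq_mul] at h
  push_cast at h
  linear_combination h

theorem derivative_binomialSeries (s : ℂ) :
    (1 + PowerSeries.X) * PowerSeries.derivative ℂ (PowerSeries.binomialSeries ℂ s) =
      PowerSeries.C s * PowerSeries.binomialSeries ℂ s := by
  ext n
  rw [add_mul, one_mul, map_add, PowerSeries.coeff_C_mul]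
  cases n with
  | zero =>
    rw [PowerSeries.coeff_zero_X_mul]
    simp [PowerSeries.coeff_derivative, PowerSeries.binomialSeries_coeff,
      -PowerSeries.coeff_zero_eq_constantCoeff]
  | succ n =>
    rw [PowerSeries.coeff_succ_X_mul]
    simp only [PowerSeries.coeff_derivative, PowerSeries.binomialSeries_coeff, smul_eq_mul, mul_one]
    have h := choose_succ_mul s (n + 1)
    push_cast at h ⊢
    linear_combination h

theorem derivative_cpow {u : PowerSeries ℂ} (hu : PowerSeries.constantCoeff u = 1) (s : ℂ) :
    u * PowerSeries.derivative ℂ (cpow u s) =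
      PowerSeries.C s * cpow u s * PowerSeries.derivative ℂ u := by
  have h0 := constantCoeff_sub_one hu
  have h := hasSubst_of_constantCoeff h0
  have := congrArg (PowerSeries.subst (u - 1)) (derivative_binomialSeries s)
  rw [PowerSeries.subst_mul h, PowerSeries.subst_add h, subst_one h0, PowerSeries.subst_X h,
    PowerSeries.subst_mul h, subst_C' h0, add_sub_cancel] at this
  rw [cpow, PowerSeries.derivative_subst h, map_sub, Derivation.map_one_eq_zero, sub_zero,
    ← mul_assoc, this]

/-- Both sides have the same logarithmic derivative and constant term `1`: the product of the left
side with `u ^ (-2s)` has derivative `0`. -/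
theorem cpow_sq {u : PowerSeries ℂ} (hu : PowerSeries.constantCoeff u = 1) (s : ℂ) :
    cpow (u ^ 2) s = cpow u (2 * s) := by
  have hu2 : PowerSeries.constantCoeff (u ^ 2) = 1 := by simp [hu]
  have hu0 : u ≠ 0 := by rintro rfl; simp at hu
  have h₁ := derivative_cpow hu2 s
  have h₂ := derivative_cpow hu (-(2 * s))
  have h : cpow (u ^ 2) s * cpow u (-(2 * s)) = 1 := by
    refine PowerSeries.derivative.ext ?_ (by simp [constantCoeff_cpow, hu])
    rw [Derivation.map_one_eq_zero, Derivation.leibniz]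
    refine (mul_right_inj' (pow_ne_zero 2 hu0)).1 ?_
    simp only [smul_eq_mul, PowerSeries.derivative_pow] at h₁ ⊢
    have hC : (PowerSeries.C (-(2 * s)) : PowerSeries ℂ) = -(2 * PowerSeries.C s) := by
      rw [map_neg, map_mul, map_ofNat]
    rw [hC] at h₂
    push_cast at h₁
    linear_combination cpow u (-(2 * s)) * h₁ + u * cpow (u ^ 2) s * h₂
  calc cpow (u ^ 2) s = cpow (u ^ 2) s * (cpow u (-(2 * s)) * cpow u (2 * s)) := by
        rw [← cpow_add hu, neg_add_cancel, cpow_zero hu, mul_one]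
    _ = cpow u (2 * s) := by rw [← mul_assoc, h, one_mul]

theorem coeff_cpow_one_add (t s : ℂ) (n : ℕ) :
    PowerSeries.coeff n (cpow (1 + PowerSeries.C t * PowerSeries.X) s) =
      Ring.choose s n * t ^ n := by
  rw [cpow, add_sub_cancel_left, ← PowerSeries.smul_eq_C_mul, ← PowerSeries.rescale_eq_subst,
    PowerSeries.coeff_rescale, PowerSeries.binomialSeries_coeff, smul_eq_mul, mul_one, mul_comm]

/-! ### The series of the Jacobi family -/

section JacobiSeries

variable (a lam : ℂ)

/-- `1 + λ a y / 2`. -/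
noncomputable def jacobiU : PowerSeries ℂ := 1 + PowerSeries.C (lam * a / 2) * PowerSeries.X

theorem constantCoeff_jacobiU : PowerSeries.constantCoeff (jacobiU a lam) = 1 := by
  simp [jacobiU]

/-- The series `y / (1 + λ a y / 2) ^ 2`. -/
noncomputable def jacobiV : PowerSeries ℂ := PowerSeries.X * cpow (jacobiU a lam) (-2)

theorem constantCoeff_jacobiV : PowerSeries.constantCoeff (jacobiV a lam) = 0 := by
  simp [jacobiV]

theorem coeff_cpow_jacobiU_mul_jacobiV_pow (s : ℂ) (n k : ℕ) :
    PowerSeries.coeff n (cpow (jacobiU a lam) s * jacobiV a lam ^ k) =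
      if k ≤ n then Ring.choose (s - 2 * k) (n - k) * (lam * a / 2) ^ (n - k) else 0 := by
  rw [jacobiV, mul_pow, ← cpow_nsmul (constantCoeff_jacobiU a lam), mul_left_comm,
    ← cpow_add (constantCoeff_jacobiU a lam), PowerSeries.coeff_X_pow_mul', jacobiU,
    coeff_cpow_one_add, show s + k * -2 = s - 2 * k by ring]

theorem constantCoeff_derivS_jacobif :
    PowerSeries.constantCoeff (derivS (jacobif a lam)) = 1 := by
  rw [deriv_jacobif]
  simp [constantCoeff_jacobif]

theorem coeff_one_jacobif : PowerSeries.coeff 1 (jacobif a lam) = 1 := by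
  have h := constantCoeff_derivS_jacobif a lam
  rw [← PowerSeries.coeff_zero_eq_constantCoeff_apply, derivS, PowerSeries.coeff_derivative] at h
  simpa using h

theorem frakT_mul_derivS : frakT (jacobif a lam) * derivS (jacobif a lam) = jacobif a lam := by
  rw [frakT, mul_assoc, PowerSeries.inv_mul_cancel _ (by simp [constantCoeff_derivS_jacobif]),
    mul_one]

theorem constantCoeff_frakT : PowerSeries.constantCoeff (frakT (jacobif a lam)) = 0 := by
  simp [frakT, constantCoeff_jacobif]

theorem coeff_one_frakT : PowerSeries.coeff 1 (frakT (jacobif a lam)) = 1 := by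
  have h := congrArg (PowerSeries.coeff 1) (frakT_mul_derivS a lam)
  rw [coeff_one_jacobif, PowerSeries.coeff_mul, Finset.Nat.antidiagonal_succ] at h
  simpa [constantCoeff_frakT, constantCoeff_derivS_jacobif] using h

theorem derivS_jacobif_subst :
    (derivS (jacobif a lam)).subst (compInv (jacobif a lam)) = jacobiU a lam ^ 2 := by
  have h0 := constantCoeff_compInv (jacobif a lam)
  have hs := hasSubst_of_constantCoeff h0
  rw [deriv_jacobif, PowerSeries.subst_pow hs, PowerSeries.subst_add hs, PowerSeries.subst_mul hs,
    subst_one h0, subst_C' h0, subst_compInv (constantCoeff_jacobif a lam)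
      (by rw [coeff_one_jacobif]; exact one_ne_zero), jacobiU]

theorem frakT_jacobif_subst :
    (frakT (jacobif a lam)).subst (compInv (jacobif a lam)) = jacobiV a lam := by
  have h0 := constantCoeff_compInv (jacobif a lam)
  have hs := hasSubst_of_constantCoeff h0
  have h := congrArg (PowerSeries.subst (compInv (jacobif a lam))) (frakT_mul_derivS a lam)
  rw [PowerSeries.subst_mul hs, derivS_jacobif_subst, subst_compInv (constantCoeff_jacobif a lam)
    (by rw [coeff_one_jacobif]; exact one_ne_zero)] at h
  have hu := constantCoeff_jacobiU a lam
  have hU : jacobiU a lam ^ 2 * cpow (jacobiU a lam) (-2) = 1 := by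
    rw [← cpow_natCast hu, ← cpow_add hu]
    simp [cpow_zero hu]
  rw [jacobiV]
  linear_combination cpow (jacobiU a lam) (-2) * h -
    (frakT (jacobif a lam)).subst (compInv (jacobif a lam)) * hU

/-- As `V = (f / f')(φ)` and `ω` inverts `f / f'`, one has `ω(V) = φ`, so `f'(ω(V)) = f'(φ)`. -/
theorem jacobiW_subst : (jacobiW a lam).subst (jacobiV a lam) = jacobiU a lam ^ 2 := by
  have h0 := constantCoeff_compInv (jacobif a lam)
  have hV := hasSubst_of_constantCoeff (constantCoeff_jacobiV a lam)
  have hT := hasSubst_of_constantCoeff (constantCoeff_frakT a lam)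
  have hω := hasSubst_of_constantCoeff (constantCoeff_compInv (frakT (jacobif a lam)))
  rw [jacobiW, jacobiOmega, PowerSeries.subst_comp_subst_apply hω hV, ← frakT_jacobif_subst,
    ← PowerSeries.subst_comp_subst_apply hT (hasSubst_of_constantCoeff h0),
    compInv_subst (constantCoeff_frakT a lam) (by rw [coeff_one_frakT]; exact one_ne_zero),
    PowerSeries.subst_X (hasSubst_of_constantCoeff h0), derivS_jacobif_subst]

theorem constantCoeff_jacobiW : PowerSeries.constantCoeff (jacobiW a lam) = 1 := by
  rw [jacobiW, jacobiOmega, constantCoeff_subst_of_zero (constantCoeff_compInv _),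
    constantCoeff_derivS_jacobif]

/-- `(-2 u - 2 / λ choose d) (λ a / 2) ^ d`. -/
noncomputable def jacobiBinom (u : ℂ) (d : ℕ) : ℂ :=
  Ring.choose (-2 * u - 2 / lam) d * (lam * a / 2) ^ d

/-- This is the coefficient of `y ^ n` in `U ^ (-2u - 2/λ) · W(V) ^ (u + 1/λ) = 1`, where `W =
f'(ω)`. It serves three times: at `u = c - 1` for the boundary term, at `u = c` for the moments, and
at general `u` as a triangular system that determines the coefficients of the power of `W`. -/
theorem sum_coeff_cpow_jacobiW (u : ℂ) (n : ℕ) :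
    ∑ j ∈ Finset.range (n + 1), PowerSeries.coeff j (cpow (jacobiW a lam) (u + 1 / lam)) *
      jacobiBinom a lam (j + u) (n - j) = if n = 0 then 1 else 0 := by
  have hu := constantCoeff_jacobiU a lam
  have h : cpow (jacobiU a lam) (-2 * (u + 1 / lam)) *
      (cpow (jacobiW a lam) (u + 1 / lam)).subst (jacobiV a lam) = 1 := by
    rw [cpow_subst (constantCoeff_jacobiW a lam) (constantCoeff_jacobiV a lam), jacobiW_subst,
      cpow_sq hu, ← cpow_add hu, show -2 * (u + 1 / lam) + 2 * (u + 1 / lam) = 0 by ring,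
      cpow_zero hu]
  have hn := congrArg (PowerSeries.coeff n) h
  rw [coeff_mul_subst (constantCoeff_jacobiV a lam), PowerSeries.coeff_one] at hn
  rw [← hn]
  refine Finset.sum_congr rfl fun j hj => ?_
  rw [coeff_cpow_jacobiU_mul_jacobiV_pow, if_pos (by simp at hj; omega), jacobiBinom,
    show -2 * (u + 1 / lam) - 2 * (j : ℂ) = -2 * (j + u) - 2 / lam by ring]

/-- The operator `C_{𝔗f}⁻¹ f'(D)^{-u-1/λ} C_f`. -/
noncomputable def jacobiCore (u : ℂ) : Module.End ℂ (Polynomial ℂ) :=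
  Ring.inverse (umbralC (frakT (jacobif a lam))) *
    seriesD (cpow (derivS (jacobif a lam)) (-u - 1 / lam)) * umbralC (jacobif a lam)

theorem coeff_jacobiCore (u : ℂ) (n k : ℕ) :
    (jacobiCore a lam u (Polynomial.X ^ n)).coeff k =
      if k ≤ n then (n.factorial : ℂ) / (k.factorial : ℂ) * jacobiBinom a lam (k + u) (n - k)
      else 0 := by
  have h0 := constantCoeff_compInv (jacobif a lam)
  have hX : PowerSeries.constantCoeff (PowerSeries.X : PowerSeries ℂ) = 0 := by simp
  have hT := constantCoeff_frakT a lam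
  rw [jacobiCore, inverse_umbralC hT (by rw [coeff_one_frakT]; exact one_ne_zero), umbralC,
    expSubst_eq_sheffer, seriesD_eq_sheffer, sheffer_mul hT hX, sheffer_mul
      (by rw [constantCoeff_subst_of_zero hX, hT]) h0, subst_one hX, mul_one, one_mul,
    cpow_subst (constantCoeff_derivS_jacobif a lam) h0, derivS_jacobif_subst,
    cpow_sq (constantCoeff_jacobiU a lam),
    PowerSeries.subst_comp_subst_apply (hasSubst_of_constantCoeff hX)
      (hasSubst_of_constantCoeff h0), PowerSeries.subst_X (hasSubst_of_constantCoeff h0),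
    frakT_jacobif_subst, coeff_sheffer (constantCoeff_jacobiV a lam),
    coeff_cpow_jacobiU_mul_jacobiV_pow, jacobiBinom, mul_ite, mul_zero,
    show 2 * (-u - 1 / lam) - 2 * (k : ℂ) = -2 * (k + u) - 2 / lam by ring]

end JacobiSeries

/-! ### The rational identities behind the three-term relation -/

/-- Hypotheses on the parameters of the associated Jacobi family. -/
structure Admissible (lam kap bet r c : ℂ) : Prop where
  lam_ne : lam ≠ 0
  kap_ne : kap ≠ 0
  inv_sub_inv : 1 / kap - 1 / lam = 1 / 2
  bet_eq : bet = r * kap + (1 - r) * lam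
  add_one_ne : ∀ n : ℕ, c + 1 + n ≠ 0
  factor_ne : ∀ n : ℕ, 1 + lam * (c + n) ≠ 0 ∧ 1 + kap * (c + n) ≠ 0 ∧ 1 + bet * (c + n) ≠ 0
  pred_ne : c = 0 ∨ (1 + lam * (c - 1) ≠ 0 ∧ 1 + kap * (c - 1) ≠ 0)

/-- `B_z` without the factor `ρ(z - 1)`. -/
noncomputable def jacobiB' (a lam kap r z : ℂ) : ℂ :=
  lam * a ^ 2 / 4 * ((2 + lam * (z - 1)) * (r * (1 + kap * (z - 1)) + (1 - r) * (1 + lam * z))) /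
    ((1 + lam * z) * (1 + kap * (z - 1)))

theorem jacobiB_eq (a lam kap bet r z : ℂ) :
    jacobiB a lam kap bet r z = jacobiB' a lam kap r z * jacobiRatio lam kap bet (z - 1) := rfl

section Rational

variable {a lam kap bet r : ℂ}

/-- With `m = 1 / λ` the relation between `λ` and `κ` is solved rationally, so the identities below
have only free variables. -/
theorem exists_param (hlam : lam ≠ 0) (hlk : 1 / kap - 1 / lam = 1 / 2) (hkap : kap ≠ 0) :
    ∃ m : ℂ, m ≠ 0 ∧ 2 * m + 1 ≠ 0 ∧ lam = 1 / m ∧ kap = 2 / (2 * m + 1) := by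
  have hm : 1 / lam ≠ 0 := one_div_ne_zero hlam
  have hk : kap * (2 * (1 / lam) + 1) = 2 := by
    field_simp at hlk ⊢
    linear_combination -hlk
  have hm1 : 2 * (1 / lam) + 1 ≠ 0 := fun h => by rw [h] at hk; simp at hk
  exact ⟨1 / lam, hm, hm1, by simp, by rw [eq_div_iff hm1, hk]⟩

theorem one_add_lam_mul {m : ℂ} (hm : m ≠ 0) (z : ℂ) : 1 + 1 / m * z = (m + z) / m := by
  field_simp

theorem one_add_kap_mul {m : ℂ} (hm : 2 * m + 1 ≠ 0) (z : ℂ) :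
    1 + 2 / (2 * m + 1) * z = (2 * m + 1 + 2 * z) / (2 * m + 1) := by
  field_simp

/-- Here `u` is the shifted column index, `u + d` the shifted row index, and `p`, `q`, `s` stand for
consecutive binomial coefficients with upper entry `b = -2u - 2/λ`. Column `u - 1` has upper entry
`b + 2`, whence `s + 2q + p` by Pascal's rule. The recursions `hq` and `hs` reduce everything to a
multiple of `p`. -/
theorem jacobi_identity_rational {u d q s : ℂ} (p : ℂ) (hlam : lam ≠ 0) (hkap : kap ≠ 0)
    (hlk : 1 / kap - 1 / lam = 1 / 2) (hbet : bet = r * kap + (1 - r) * lam)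
    (h₁ : 1 + lam * (u + d) ≠ 0) (h₂ : 1 + kap * (u + d) ≠ 0) (h₃ : 1 + kap * (u + d - 1) ≠ 0)
    (hu : u = 0 ∨ (1 + lam * (u - 1) ≠ 0 ∧ 1 + kap * (u - 1) ≠ 0))
    (hd : d ≠ 0) (hd' : d + 1 ≠ 0)
    (hq : q * d = (-2 * u - 2 / lam - (d - 1)) * p) (hs : s * (d + 1) = (-2 * u - 2 / lam - d) * q) :
    u * jacobiRatio lam kap bet (u - 1) * (s + 2 * q + p) * (lam * a / 2) ^ 2 =
      (u + d + 1) * jacobiRatio lam kap bet (u + d) * s * (lam * a / 2) ^ 2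
      + jacobiA a lam kap r (u + d) * q * (lam * a / 2)
      + jacobiB' a lam kap r (u + d) * p := by
  obtain ⟨m, hm, hm1, rfl, rfl⟩ := exists_param hlam hlk hkap
  obtain rfl : q = (-2 * u - 2 / (1 / m) - (d - 1)) / d * p := by field_simp at hq ⊢; exact hq
  obtain rfl := (eq_div_iff hd').2 hs
  simp only [jacobiRatio, jacobiA, jacobiB', one_add_lam_mul hm, one_add_kap_mul hm1, hbet] at *
  replace h₁ := (div_ne_zero_iff.1 h₁).1
  replace h₂ := (div_ne_zero_iff.1 h₂).1
  replace h₃ := (div_ne_zero_iff.1 h₃).1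
  -- At `u = 0` the factor `u` removes `ρ(u - 1)`, whose denominators need not be nonzero.
  rcases hu with rfl | ⟨h₄, h₅⟩
  · simp only [zero_add, zero_mul, mul_zero] at *
    have h₂' : 2 * m + 1 + d * 2 ≠ 0 := by rwa [mul_comm d 2]
    field_simp
    ring
  · replace h₄ := (div_ne_zero_iff.1 h₄).1
    replace h₅ := (div_ne_zero_iff.1 h₅).1
    field_simp
    ring

/-- The case of equal row and column index. The `B` term is absent because it would multiply an
entry above the diagonal. -/
theorem jacobi_identity_diag {u : ℂ} (hlam : lam ≠ 0) (hkap : kap ≠ 0)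
    (hlk : 1 / kap - 1 / lam = 1 / 2) (hbet : bet = r * kap + (1 - r) * lam)
    (h₁ : 1 + lam * u ≠ 0) (h₂ : 1 + kap * u ≠ 0)
    (hu : u = 0 ∨ (1 + lam * (u - 1) ≠ 0 ∧ 1 + kap * (u - 1) ≠ 0)) :
    u * jacobiRatio lam kap bet (u - 1) * ((-2 * u - 2 / lam) + 2) * (lam * a / 2) =
      (u + 1) * jacobiRatio lam kap bet u * (-2 * u - 2 / lam) * (lam * a / 2)
      + jacobiA a lam kap r u := by
  obtain ⟨m, hm, hm1, rfl, rfl⟩ := exists_param hlam hlk hkap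
  rcases hu with rfl | ⟨h₄, h₅⟩
  · simp only [jacobiRatio, jacobiA, mul_zero, zero_mul, add_zero, zero_add, zero_div]
    field_simp
    ring
  · simp only [jacobiRatio, jacobiA, one_add_lam_mul hm, one_add_kap_mul hm1, hbet] at *
    replace h₁ := (div_ne_zero_iff.1 h₁).1
    replace h₂ := (div_ne_zero_iff.1 h₂).1
    replace h₄ := (div_ne_zero_iff.1 h₄).1
    replace h₅ := (div_ne_zero_iff.1 h₅).1
    have h₂' : 2 * m + 1 + u * 2 ≠ 0 := by rwa [mul_comm u 2]
    field_simp
    ring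

theorem choose_add_two (b : ℂ) (d : ℕ) :
    Ring.choose (b + 2) (d + 2) =
      Ring.choose b (d + 2) + 2 * Ring.choose b (d + 1) + Ring.choose b d := by
  rw [show b + 2 = b + 1 + 1 by ring, Ring.choose_succ_succ, Ring.choose_succ_succ,
    Ring.choose_succ_succ]
  ring

theorem jacobiBinom_identity {u : ℂ} {d : ℕ} (hlam : lam ≠ 0) (hkap : kap ≠ 0)
    (hlk : 1 / kap - 1 / lam = 1 / 2) (hbet : bet = r * kap + (1 - r) * lam)
    (h₁ : 1 + lam * (u + (d + 1)) ≠ 0) (h₂ : 1 + kap * (u + (d + 1)) ≠ 0)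
    (h₃ : 1 + kap * (u + d) ≠ 0)
    (hu : u = 0 ∨ (1 + lam * (u - 1) ≠ 0 ∧ 1 + kap * (u - 1) ≠ 0)) :
    u * jacobiRatio lam kap bet (u - 1) * jacobiBinom a lam (u - 1) (d + 2) =
      (u + (d + 1) + 1) * jacobiRatio lam kap bet (u + (d + 1)) * jacobiBinom a lam u (d + 2)
      + jacobiA a lam kap r (u + (d + 1)) * jacobiBinom a lam u (d + 1)
      + jacobiB' a lam kap r (u + (d + 1)) * jacobiBinom a lam u d := by
  have hq := choose_succ_mul (-2 * u - 2 / lam) d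
  have hs := choose_succ_mul (-2 * u - 2 / lam) (d + 1)
  have hd : (d : ℂ) + 1 ≠ 0 := by exact_mod_cast Nat.succ_ne_zero d
  have hd' : (d : ℂ) + 1 + 1 ≠ 0 := by exact_mod_cast Nat.succ_ne_zero (d + 1)
  push_cast at hs
  -- The distance between row and column is `d + 1`, so `p`, `q`, `s` are the binomials of order
  -- `d`, `d + 1`, `d + 2`.
  have h := jacobi_identity_rational (a := a) (r := r)
    (Ring.choose (-2 * u - 2 / lam) d) hlam hkap hlk hbet h₁ h₂
    (by rwa [show u + ((d : ℂ) + 1) - 1 = u + d by ring]) hu hd hd'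
    (by rw [hq]; ring) hs
  simp only [jacobiBinom, show -2 * (u - 1) - 2 / lam = -2 * u - 2 / lam + 2 by ring,
    choose_add_two]
  linear_combination (lam * a / 2) ^ d * h

theorem jacobiBinom_identity_diag {u : ℂ} (hlam : lam ≠ 0) (hkap : kap ≠ 0)
    (hlk : 1 / kap - 1 / lam = 1 / 2) (hbet : bet = r * kap + (1 - r) * lam)
    (h₁ : 1 + lam * u ≠ 0) (h₂ : 1 + kap * u ≠ 0)
    (hu : u = 0 ∨ (1 + lam * (u - 1) ≠ 0 ∧ 1 + kap * (u - 1) ≠ 0)) :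
    u * jacobiRatio lam kap bet (u - 1) * jacobiBinom a lam (u - 1) 1 =
      (u + 1) * jacobiRatio lam kap bet u * jacobiBinom a lam u 1
      + jacobiA a lam kap r u * jacobiBinom a lam u 0 := by
  have h := jacobi_identity_diag (a := a) (r := r) hlam hkap hlk hbet h₁ h₂ hu
  simp only [jacobiBinom, Ring.choose_one_right, Ring.choose_zero_right]
  linear_combination h

end Rational

/-! ### The weights `(c + n)_n ℱ_{n+c} / ℱ_c` -/

/-- `(c + n)_n ℱ_{n+c} / ℱ_c`. -/
noncomputable def jacobiWeight (lam kap bet c : ℂ) (n : ℕ) : ℂ :=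
  fall (c + n) n * jacobiF lam kap bet c n

theorem fall_succ_shift (c : ℂ) (n : ℕ) :
    fall (c + (n + 1 : ℕ)) (n + 1) = (c + n + 1) * fall (c + n) n := by
  rw [fall, fall, Finset.prod_range_succ', mul_comm]
  congr 1
  · push_cast; ring
  · exact Finset.prod_congr rfl fun j _ => by push_cast; ring

theorem fall_add_self (c : ℂ) (n : ℕ) :
    fall (c + n) (n + 1) = c * fall (c + n) n := by
  rw [fall, Finset.prod_range_succ, fall]
  ring

theorem jacobiF_succ (lam kap bet c : ℂ) (n : ℕ) :
    jacobiF lam kap bet c (n + 1) = jacobiF lam kap bet c n * jacobiRatio lam kap bet (c + n) := by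
  rw [jacobiF, Finset.prod_range_succ, jacobiF]

theorem jacobiF_pred_succ (lam kap bet c : ℂ) (n : ℕ) :
    jacobiF lam kap bet (c - 1) (n + 1) =
      jacobiRatio lam kap bet (c - 1) * jacobiF lam kap bet c n := by
  rw [jacobiF, Finset.prod_range_succ', jacobiF, mul_comm]
  congr 1
  · simp
  · exact Finset.prod_congr rfl fun j _ => by push_cast; ring_nf

theorem jacobiWeight_zero (lam kap bet c : ℂ) : jacobiWeight lam kap bet c 0 = 1 := by
  simp [jacobiWeight, fall, jacobiF]

theorem jacobiWeight_succ (lam kap bet c : ℂ) (n : ℕ) :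
    jacobiWeight lam kap bet c (n + 1) =
      (c + n + 1) * jacobiRatio lam kap bet (c + n) * jacobiWeight lam kap bet c n := by
  rw [jacobiWeight, fall_succ_shift, jacobiF_succ, jacobiWeight]
  ring

namespace Admissible

variable {lam kap bet r c : ℂ}

theorem jacobiF_ne_zero (H : Admissible lam kap bet r c) (n : ℕ) :
    jacobiF lam kap bet c n ≠ 0 := by
  refine Finset.prod_ne_zero_iff.2 fun j _ => ?_
  obtain ⟨h₁, h₂, h₃⟩ := H.factor_ne j
  exact div_ne_zero h₃ (mul_ne_zero h₁ h₂)

theorem fall_ne_zero (H : Admissible lam kap bet r c) (n : ℕ) : fall (c + n) n ≠ 0 := by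
  induction n with
  | zero => simp [fall]
  | succ n ih =>
    rw [fall_succ_shift]
    refine mul_ne_zero ?_ ih
    rw [add_right_comm]
    exact H.add_one_ne n

theorem jacobiWeight_ne_zero (H : Admissible lam kap bet r c) (n : ℕ) :
    jacobiWeight lam kap bet c n ≠ 0 :=
  mul_ne_zero (H.fall_ne_zero n) (H.jacobiF_ne_zero n)

/-- The column preceding `k` has index `k + c - 1`: for `k ≥ 1` it is covered by `factor_ne`, and
only `k = 0` needs the separate hypothesis. -/
theorem pred_ne_nat (H : Admissible lam kap bet r c) (k : ℕ) :
    (k : ℂ) + c = 0 ∨ (1 + lam * (k + c - 1) ≠ 0 ∧ 1 + kap * (k + c - 1) ≠ 0) := by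
  cases k with
  | zero => simpa using H.pred_ne
  | succ k =>
    refine Or.inr ?_
    have h := H.factor_ne k
    rw [show ((k + 1 : ℕ) : ℂ) + c - 1 = c + k by push_cast; ring]
    exact ⟨h.1, h.2.1⟩

end Admissible

/-! ### The shifted matrix -/

/-- The coefficient of `x ^ k` in the `n`-th polynomial generated by
`θ! (ℱ_c / ℱ_{θ+c}) (c + θ)_θ⁻¹ C_{𝔗f}⁻¹ f'(D)^{-c-1/λ} C_f (ℱ_{θ+c} / ℱ_c) ((c + θ)_θ / θ!)`. -/
noncomputable def jacobiEntry (a lam kap bet c : ℂ) (n k : ℕ) : ℂ :=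
  if k ≤ n then jacobiWeight lam kap bet c n / jacobiWeight lam kap bet c k *
    jacobiBinom a lam (k + c) (n - k) else 0

/-- The entry of the shifted matrix in column `-1`. -/
noncomputable def jacobiBoundary (a lam kap bet c : ℂ) (n : ℕ) : ℂ :=
  c * jacobiRatio lam kap bet (c - 1) * jacobiWeight lam kap bet c n *
    jacobiBinom a lam (c - 1) (n + 1)

section Entries

variable {a lam kap bet r c : ℂ}

theorem jacobiBinom_zero (u : ℂ) : jacobiBinom a lam u 0 = 1 := by
  simp [jacobiBinom]

theorem jacobiEntry_self (H : Admissible lam kap bet r c) (n : ℕ) :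
    jacobiEntry a lam kap bet c n n = 1 := by
  simp [jacobiEntry, jacobiBinom_zero, div_self (H.jacobiWeight_ne_zero n)]

theorem jacobiEntry_of_lt {n k : ℕ} (h : n < k) : jacobiEntry a lam kap bet c n k = 0 :=
  if_neg (by omega)

theorem jacobiEntry_add (k d : ℕ) :
    jacobiEntry a lam kap bet c (k + d) k = jacobiWeight lam kap bet c (k + d) /
      jacobiWeight lam kap bet c k * jacobiBinom a lam (k + c) d := by
  rw [jacobiEntry, if_pos (by omega), Nat.add_sub_cancel_left]

/-- The three-term relation with the shifted entry written without reference to its column. -/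
theorem jacobiEntry_step (H : Admissible lam kap bet r c) (k d : ℕ) :
    (k + c) * jacobiRatio lam kap bet (k + c - 1) * (jacobiWeight lam kap bet c (k + d + 1) /
      jacobiWeight lam kap bet c k) * jacobiBinom a lam (k + c - 1) (d + 2) =
      jacobiEntry a lam kap bet c (k + d + 2) k
      + jacobiA a lam kap r ((k + d : ℕ) + 1 + c) * jacobiEntry a lam kap bet c (k + d + 1) k
      + ((k + d : ℕ) + 1 + c) * jacobiB a lam kap bet r ((k + d : ℕ) + 1 + c) *
        jacobiEntry a lam kap bet c (k + d) k := by
  have h₁ := H.factor_ne (k + d + 1)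
  have h₃ := (H.factor_ne (k + d)).2.1
  have e : (k : ℂ) + c + (d + 1) = c + (k + d + 1 : ℕ) := by push_cast; ring
  have h := jacobiBinom_identity (a := a) (r := r) (d := d) H.lam_ne H.kap_ne H.inv_sub_inv
    H.bet_eq (by rw [e]; exact h₁.1) (by rw [e]; exact h₁.2.1)
    (by rw [show (k : ℂ) + c + d = c + (k + d : ℕ) by push_cast; ring]; exact h₃) (H.pred_ne_nat k)
  have w₁ := jacobiWeight_succ lam kap bet c (k + d)
  have w₂ := jacobiWeight_succ lam kap bet c (k + d + 1)
  have e₂ := jacobiEntry_add (a := a) (lam := lam) (kap := kap) (bet := bet) (c := c) k (d + 2)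
  have e₁ := jacobiEntry_add (a := a) (lam := lam) (kap := kap) (bet := bet) (c := c) k (d + 1)
  simp only [← add_assoc] at e₁ e₂
  rw [jacobiEntry_add, e₁, e₂, w₂, jacobiB_eq]
  rw [e] at h
  rw [show ((k + d : ℕ) : ℂ) + 1 + c = c + (k + d + 1 : ℕ) by push_cast; ring,
    show c + ((k + d + 1 : ℕ) : ℂ) - 1 = c + (k + d : ℕ) by push_cast; ring]
  have e₃ : (c + ((k + d : ℕ) : ℂ) + 1) = c + (k + d + 1 : ℕ) := by push_cast; ring
  rw [e₃] at w₁
  have hk := H.jacobiWeight_ne_zero k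
  -- The binomial identity is multiplied by the weight quotient. In the last term `z ρ(z - 1)` is
  -- the quotient of consecutive weights, which is why that identity involves `jacobiB'` instead of
  -- `jacobiB`.
  linear_combination (jacobiWeight lam kap bet c (k + d + 1) / jacobiWeight lam kap bet c k) * h +
    jacobiB' a lam kap r (c + (k + d + 1 : ℕ)) * jacobiBinom a lam (k + c) d /
      jacobiWeight lam kap bet c k * w₁

theorem jacobiEntry_step_diag (H : Admissible lam kap bet r c) (k : ℕ) :
    (k + c) * jacobiRatio lam kap bet (k + c - 1) * jacobiBinom a lam (k + c - 1) 1 =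
      jacobiEntry a lam kap bet c (k + 1) k + jacobiA a lam kap r (k + c) := by
  have h₁ := H.factor_ne k
  rw [add_comm c] at h₁
  have h := jacobiBinom_identity_diag (a := a) (r := r) H.lam_ne H.kap_ne H.inv_sub_inv
    H.bet_eq h₁.1 h₁.2.1 (H.pred_ne_nat k)
  have hk := H.jacobiWeight_ne_zero k
  rw [h, jacobiEntry_add, jacobiWeight_succ, jacobiBinom_zero, mul_div_assoc, div_self hk,
    add_comm c]
  ring

/-- Identifies the column-free expression of `jacobiEntry_step` at `k + 1` with the genuine entry in
column `k`; at column `0` there is no such entry, and the expression becomes the boundary term. -/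
theorem jacobiEntry_pred (H : Admissible lam kap bet r c) (k d : ℕ) :
    jacobiEntry a lam kap bet c (k + d) k =
      ((k + 1 : ℕ) + c) * jacobiRatio lam kap bet ((k + 1 : ℕ) + c - 1) *
        (jacobiWeight lam kap bet c (k + d) / jacobiWeight lam kap bet c (k + 1)) *
        jacobiBinom a lam ((k + 1 : ℕ) + c - 1) d := by
  have h₁ := H.jacobiWeight_ne_zero (k + 1)
  have h₀ := H.jacobiWeight_ne_zero k
  have w := jacobiWeight_succ lam kap bet c k
  rw [jacobiEntry_add, show ((k + 1 : ℕ) : ℂ) + c - 1 = k + c by push_cast; ring,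
    show ((k + 1 : ℕ) : ℂ) + c = c + k + 1 by push_cast; ring, add_comm (k : ℂ) c]
  field_simp
  linear_combination (jacobiWeight lam kap bet c (k + d) * jacobiBinom a lam (c + k) d) * w

/-- The polynomial with the coefficients `jacobiEntry`. -/
noncomputable def jacobiRow (a lam kap bet c : ℂ) (n : ℕ) : Polynomial ℂ :=
  ∑ k ∈ Finset.range (n + 1), Polynomial.C (jacobiEntry a lam kap bet c n k) * Polynomial.X ^ k

theorem coeff_jacobiRow (n k : ℕ) :
    (jacobiRow a lam kap bet c n).coeff k = jacobiEntry a lam kap bet c n k := by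
  rw [jacobiRow, coeff_sum_C_mul_X_pow]
  split_ifs with h
  · rfl
  · rw [jacobiEntry_of_lt (by omega)]

theorem jacobiRow_zero (H : Admissible lam kap bet r c) : jacobiRow a lam kap bet c 0 = 1 := by
  simp [jacobiRow, jacobiEntry_self H]

theorem X_mul_jacobiRow_zero (H : Admissible lam kap bet r c) :
    Polynomial.X * jacobiRow a lam kap bet c 0 = jacobiRow a lam kap bet c 1 +
      Polynomial.C (jacobiA a lam kap r c) * jacobiRow a lam kap bet c 0 -
      Polynomial.C (jacobiBoundary a lam kap bet c 0) := by
  ext k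
  simp only [Polynomial.coeff_sub, Polynomial.coeff_add, Polynomial.coeff_C_mul, coeff_jacobiRow]
  rcases k with _ | _ | k
  · have h := jacobiEntry_step_diag (a := a) H 0
    simp only [Nat.cast_zero, zero_add] at h
    simp only [Polynomial.coeff_X_mul_zero, Polynomial.coeff_C_zero, jacobiBoundary,
      jacobiWeight_zero, jacobiEntry_self H, zero_add]
    linear_combination h
  · simp [Polynomial.coeff_X_mul, coeff_jacobiRow, jacobiEntry_self H, jacobiEntry_of_lt]
  · simp [Polynomial.coeff_X_mul, coeff_jacobiRow, jacobiEntry_of_lt]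

theorem X_mul_jacobiRow_succ (H : Admissible lam kap bet r c) (n : ℕ) :
    Polynomial.X * jacobiRow a lam kap bet c (n + 1) = jacobiRow a lam kap bet c (n + 2) +
      Polynomial.C (jacobiA a lam kap r (n + 1 + c)) * jacobiRow a lam kap bet c (n + 1) +
      Polynomial.C ((n + 1 + c) * jacobiB a lam kap bet r (n + 1 + c)) *
        jacobiRow a lam kap bet c n -
      Polynomial.C (jacobiBoundary a lam kap bet c (n + 1)) := by
  ext k
  simp only [Polynomial.coeff_sub, Polynomial.coeff_add, Polynomial.coeff_C_mul, coeff_jacobiRow]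
  cases k with
  | zero =>
    have h := jacobiEntry_step (a := a) H 0 n
    simp only [Nat.cast_zero, zero_add, jacobiWeight_zero, div_one] at h
    rw [Polynomial.coeff_X_mul_zero, Polynomial.coeff_C_zero, jacobiBoundary]
    linear_combination h
  | succ k =>
    rw [Polynomial.coeff_X_mul, coeff_jacobiRow, Polynomial.coeff_C, if_neg (Nat.succ_ne_zero k),
      sub_zero]
    -- The column is `k + 1` and the row `n + 1`. Right of the diagonal only the leading
    -- coefficients matter; on the diagonal and left of it the two entry relations apply.
    rcases lt_trichotomy n k with hk | rfl | hk
    · rcases Nat.lt_or_ge (n + 1) k with hk' | hk'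
      · simp [jacobiEntry_of_lt (show n + 1 < k by omega),
          jacobiEntry_of_lt (show n + 2 < k + 1 by omega),
          jacobiEntry_of_lt (show n + 1 < k + 1 by omega),
          jacobiEntry_of_lt (show n < k + 1 by omega)]
      · obtain rfl : k = n + 1 := by omega
        simp [jacobiEntry_self H, jacobiEntry_of_lt]
    · have h := jacobiEntry_step_diag (a := a) H (n + 1)
      have h' := jacobiEntry_pred (a := a) H n 1
      rw [div_self (H.jacobiWeight_ne_zero _), mul_one, h] at h'
      rw [h', jacobiEntry_self H, jacobiEntry_of_lt (Nat.lt_succ_self n)]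
      push_cast
      ring
    · obtain ⟨d, rfl⟩ := Nat.exists_eq_add_of_lt hk
      have h := jacobiEntry_step (a := a) H (k + 1) d
      have h' := jacobiEntry_pred (a := a) H k (d + 2)
      rw [show k + 1 + d + 1 = k + (d + 2) by omega] at h
      rw [← h', show k + 1 + d = k + d + 1 by omega] at h
      exact h

end Entries

/-! ### Power series in the divided difference at `0` -/

/-- The operator `∑ j, l_j Δ ^ j` where `Δ p = (p - p(0)) / x`. -/
noncomputable def seriesShift (l : PowerSeries ℂ) : Module.End ℂ (Polynomial ℂ) :=
  opOf fun n => ∑ j ∈ Finset.range (n + 1),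
    Polynomial.C (PowerSeries.coeff (n - j) l) * Polynomial.X ^ j

theorem coeff_seriesShift (l : PowerSeries ℂ) (n k : ℕ) :
    (seriesShift l (Polynomial.X ^ n)).coeff k =
      if k ≤ n then PowerSeries.coeff (n - k) l else 0 := by
  rw [seriesShift, opOf_X_pow, coeff_sum_C_mul_X_pow]
  simp only [Nat.lt_succ_iff]

/-- Conjugation by `θ!` turns `D` into `Δ`, since `D x ^ n / n! = x ^ (n-1) / (n-1)!` for `n ≥ 1`.
-/
theorem diag_factorial_mul_seriesD (l : PowerSeries ℂ) :
    diag (fun n => (n.factorial : ℂ)) * seriesD l =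
      seriesShift l * diag (fun n => (n.factorial : ℂ)) := by
  refine end_ext fun n => Polynomial.ext fun k => ?_
  rw [Module.End.mul_apply, Module.End.mul_apply, coeff_diag, coeff_seriesD, diag_X_pow, map_smul,
    Polynomial.coeff_smul, coeff_seriesShift]
  have : (k.factorial : ℂ) ≠ 0 := by exact_mod_cast k.factorial_ne_zero
  split_ifs
  · rw [smul_eq_mul]
    field_simp
  · simp

/-- `Δ ^ j (x p)` and `x Δ ^ j p` differ by a constant, so the defect is read off from the constant
term of the left side. -/
theorem seriesShift_X_mul (l : PowerSeries ℂ) (p : Polynomial ℂ) :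
    seriesShift l (Polynomial.X * p) = Polynomial.X * seriesShift l p +
      Polynomial.C ((seriesShift l (Polynomial.X * p)).coeff 0) := by
  induction p using Polynomial.induction_on' with
  | add p q hp hq =>
    rw [mul_add, map_add, Polynomial.coeff_add, map_add, map_add, mul_add]
    linear_combination hp + hq
  | monomial n z =>
    rw [← Polynomial.C_mul_X_pow_eq_monomial, ← Polynomial.smul_eq_C_mul, mul_smul_comm,
      ← pow_succ', map_smul, map_smul, mul_smul_comm, Polynomial.coeff_smul, smul_eq_mul, map_mul,
      ← Polynomial.smul_eq_C_mul, ← smul_add]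
    congr 1
    ext k
    rw [Polynomial.coeff_add]
    cases k with
    | zero => simp
    | succ k =>
      rw [Polynomial.coeff_X_mul, coeff_seriesShift, coeff_seriesShift, Polynomial.coeff_C,
        if_neg (Nat.succ_ne_zero k), add_zero]
      simp

theorem seriesShift_C {l : PowerSeries ℂ} (hl : PowerSeries.constantCoeff l = 1) (z : ℂ) :
    seriesShift l (Polynomial.C z) = Polynomial.C z := by
  have h : seriesShift l (Polynomial.X ^ 0) = 1 := by
    rw [seriesShift, opOf_X_pow]
    simp [hl]
  rw [show (Polynomial.C z : Polynomial ℂ) = z • Polynomial.X ^ 0 by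
    rw [pow_zero, Polynomial.smul_eq_C_mul, mul_one], map_smul, h, pow_zero]

/-! ### Families of monic polynomials given by a three-term relation -/

theorem isUnit_of_degree {T : Module.End ℂ (Polynomial ℂ)}
    (hT : ∀ n : ℕ, (T (Polynomial.X ^ n)).degree = n) : IsUnit T := by
  let S : Polynomial.Sequence ℂ := ⟨fun n => T (Polynomial.X ^ n), hT⟩
  have hS : ∀ i, IsUnit (S i).leadingCoeff := fun i =>
    isUnit_iff_ne_zero.2 (Polynomial.leadingCoeff_ne_zero.2 (S.ne_zero i))
  have hb : T = ((Polynomial.basisMonomials ℂ).equiv (S.basis hS) (Equiv.refl ℕ)).toLinearMap := by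
    refine (Polynomial.basisMonomials ℂ).ext fun n => ?_
    rw [LinearEquiv.coe_coe, Module.Basis.equiv_apply, Equiv.refl_apply,
      Polynomial.Sequence.basis_eq_self, Polynomial.coe_basisMonomials]
    simp only [← Polynomial.X_pow_eq_monomial]
    rfl
  rw [Module.End.isUnit_iff, hb]
  exact LinearEquiv.bijective _

theorem functional_ext {L L' : Polynomial ℂ →ₗ[ℂ] ℂ}
    (h : ∀ n : ℕ, L (Polynomial.X ^ n) = L' (Polynomial.X ^ n)) : L = L' := by
  refine (Polynomial.basisMonomials ℂ).ext fun n => ?_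
  simpa [Polynomial.coe_basisMonomials, Polynomial.X_pow_eq_monomial] using h n

theorem assocPoly_monic (A B : ℂ → ℂ) (c : ℂ) (n : ℕ) :
    (assocPoly A B c n).Monic ∧ (assocPoly A B c n).natDegree = n := by
  induction n using Nat.strong_induction_on with
  | _ n ih =>
    match n with
    | 0 => simp [assocPoly]
    | 1 => exact ⟨Polynomial.monic_X_sub_C _, Polynomial.natDegree_X_sub_C _⟩
    | n + 2 =>
      obtain ⟨h₁, d₁⟩ := ih (n + 1) (by omega)
      obtain ⟨-, d₀⟩ := ih n (by omega)
      rw [assocPoly]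
      have hm := (Polynomial.monic_X_sub_C (A (n + 1 + c))).mul h₁
      have hd : ((Polynomial.X - Polynomial.C (A (n + 1 + c))) *
          assocPoly A B c (n + 1)).natDegree = n + 2 := by
        rw [(Polynomial.monic_X_sub_C _).natDegree_mul h₁, Polynomial.natDegree_X_sub_C, d₁]
        omega
      have hlt : (Polynomial.C ((n + 1 + c) * B (n + 1 + c)) * assocPoly A B c n).degree <
          ((Polynomial.X - Polynomial.C (A (n + 1 + c))) * assocPoly A B c (n + 1)).degree := by
        refine lt_of_le_of_lt ?_ (lt_of_lt_of_eq (WithBot.coe_lt_coe.2 (show n < n + 2 by omega))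
          (by rw [Polynomial.degree_eq_natDegree hm.ne_zero, hd]; rfl))
        refine Polynomial.degree_le_of_natDegree_le ?_
        exact (Polynomial.natDegree_C_mul_le _ _).trans d₀.le
      exact ⟨hm.sub_of_left hlt, by
        rw [Polynomial.natDegree_eq_of_degree_eq (Polynomial.degree_sub_eq_left_of_degree_lt hlt),
          hd]⟩

theorem assocDualRaising_X_pow_zero (A B : ℂ → ℂ) (c : ℂ) :
    assocDualRaising A B c (Polynomial.X ^ 0) = Polynomial.X ^ 1 + A c • Polynomial.X ^ 0 := by
  simp only [assocDualRaising, LinearMap.add_apply, Module.End.mul_apply, mulX, opD,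
    LinearMap.mulLeft_apply, diag_X_pow]
  simp

theorem assocDualRaising_X_pow_succ (A B : ℂ → ℂ) (c : ℂ) (n : ℕ) :
    assocDualRaising A B c (Polynomial.X ^ (n + 1)) = Polynomial.X ^ (n + 2) +
      A (n + 1 + c) • Polynomial.X ^ (n + 1) +
      ((n + 1 + c) * B (n + 1 + c)) • Polynomial.X ^ n := by
  simp only [assocDualRaising, LinearMap.add_apply, Module.End.mul_apply, mulX, opD,
    LinearMap.mulLeft_apply, diag_X_pow, Polynomial.derivative_X_pow, Nat.add_sub_cancel,
    ← Polynomial.smul_eq_C_mul, map_smul, smul_smul]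
  have hn : (1 : ℂ) + n ≠ 0 := by rw [add_comm]; exact_mod_cast Nat.succ_ne_zero n
  push_cast
  rw [show ((n : ℂ) + 1) * ((1 + c + n) * B (n + c + 1) / (1 + n)) =
    (n + 1 + c) * B (n + 1 + c) by rw [add_right_comm (n : ℂ) 1 c]; field_simp; ring]
  congr 2
  ring

section ThreeTerm

variable {A B : ℂ → ℂ} {c : ℂ} {G : Module.End ℂ (Polynomial ℂ)}

theorem apply_X_pow_eq_assocPoly (h₀ : G (Polynomial.X ^ 0) = 1)
    (hG : mulX * G = G * assocDualRaising A B c) (n : ℕ) :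
    G (Polynomial.X ^ n) = assocPoly A B c n := by
  have hG' : ∀ p, Polynomial.X * G p = G (assocDualRaising A B c p) := fun p =>
    LinearMap.congr_fun hG p
  induction n using Nat.strong_induction_on with
  | _ n ih =>
    match n with
    | 0 => exact h₀
    | 1 =>
      have h := hG' (Polynomial.X ^ 0)
      rw [assocDualRaising_X_pow_zero, map_add, map_smul, h₀, Polynomial.smul_eq_C_mul] at h
      rw [assocPoly]
      linear_combination -h
    | n + 2 =>
      have h := hG' (Polynomial.X ^ (n + 1))
      rw [assocDualRaising_X_pow_succ, map_add, map_add, map_smul, map_smul, ih n (by omega),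
        ih (n + 1) (by omega), Polynomial.smul_eq_C_mul, Polynomial.smul_eq_C_mul] at h
      rw [assocPoly]
      linear_combination -h

theorem isUnit_of_assocPoly (hG : ∀ n : ℕ, G (Polynomial.X ^ n) = assocPoly A B c n) :
    IsUnit G := by
  refine isUnit_of_degree fun n => ?_
  obtain ⟨h, hd⟩ := assocPoly_monic A B c n
  rw [hG, Polynomial.degree_eq_natDegree h.ne_zero, hd]

/-- The orthogonality of the associated polynomials with respect to a functional `L` with
`L p_0 = 1` and `L p_n = 0` for `n ≥ 1`. -/
theorem assocPoly_orthogonal {L : Polynomial ℂ →ₗ[ℂ] ℂ}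
    (hL : ∀ n : ℕ, L (assocPoly A B c n) = if n = 0 then 1 else 0) (m n : ℕ) :
    L (assocPoly A B c m * assocPoly A B c n) =
      if m = n then ∏ j ∈ Finset.range n, (j + 1 + c) * B (j + 1 + c) else 0 := by
  have hX₀ : Polynomial.X * assocPoly A B c 0 = assocPoly A B c 1 + A c • assocPoly A B c 0 := by
    rw [assocPoly, assocPoly, Polynomial.smul_eq_C_mul]
    ring
  have hX : ∀ n : ℕ, Polynomial.X * assocPoly A B c (n + 1) = assocPoly A B c (n + 2) +
      A (n + 1 + c) • assocPoly A B c (n + 1) +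
      ((n + 1 + c) * B (n + 1 + c)) • assocPoly A B c n := by
    intro n
    rw [assocPoly, Polynomial.smul_eq_C_mul, Polynomial.smul_eq_C_mul]
    ring
  -- The recurrence for `p_m` introduces a factor `x`, which is moved over to `p_n` and expanded
  -- there. This expresses the pairing at `m` by pairings with smaller first index and neighbouring
  -- second index.
  induction m using Nat.strong_induction_on generalizing n with
  | _ m ih =>
    match m with
    | 0 =>
      rw [show assocPoly A B c 0 = 1 from rfl, one_mul, hL]
      rcases n with _ | n <;> simp
    | 1 =>
      have ih0 := ih 0 one_pos
      have h₁ : assocPoly A B c 1 * assocPoly A B c n =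
          assocPoly A B c 0 * (Polynomial.X * assocPoly A B c n) -
            A c • (assocPoly A B c 0 * assocPoly A B c n) := by
        rw [show assocPoly A B c 0 = 1 from rfl, show assocPoly A B c 1 =
          Polynomial.X - Polynomial.C (A c) from rfl, Polynomial.smul_eq_C_mul]
        ring
      rw [h₁]
      rcases n with _ | n
      · rw [hX₀, mul_add, mul_smul_comm, map_sub, map_add, map_smul, ih0, ih0]
        simp
      · rw [hX, mul_add, mul_add, mul_smul_comm, mul_smul_comm, map_sub, map_add, map_add, map_smul,
          map_smul, map_smul, ih0, ih0, ih0]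
        rcases n with _ | n <;> simp
    | m + 2 =>
      have ih₁ := ih (m + 1) (by omega)
      have ih₀ := ih m (by omega)
      have h₁ : assocPoly A B c (m + 2) * assocPoly A B c n =
          assocPoly A B c (m + 1) * (Polynomial.X * assocPoly A B c n) -
            A (m + 1 + c) • (assocPoly A B c (m + 1) * assocPoly A B c n) -
            ((m + 1 + c) * B (m + 1 + c)) • (assocPoly A B c m * assocPoly A B c n) := by
        rw [show assocPoly A B c (m + 2) = (Polynomial.X - Polynomial.C (A (m + 1 + c))) *
          assocPoly A B c (m + 1) - Polynomial.C ((m + 1 + c) * B (m + 1 + c)) *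
          assocPoly A B c m from rfl, Polynomial.smul_eq_C_mul, Polynomial.smul_eq_C_mul]
        ring
      rw [h₁]
      rcases n with _ | n
      · rw [hX₀, mul_add, mul_smul_comm, map_sub, map_sub, map_add, map_smul, map_smul, map_smul,
          ih₁, ih₁, ih₀]
        rcases m with _ | m <;> simp
      · rw [hX, mul_add, mul_add, mul_smul_comm, mul_smul_comm, map_sub, map_sub, map_add, map_add,
          map_smul, map_smul, map_smul, map_smul, ih₁, ih₁, ih₁, ih₀]
        simp only [smul_eq_mul, Nat.succ_inj]
        rcases lt_trichotomy m n with h | rfl | h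
        · by_cases h' : m + 1 = n
          · subst h'
            simp [Finset.prod_range_succ, show m ≠ m + 1 + 1 by omega]
            ring
          · simp [h.ne, h', show m ≠ n + 1 by omega]
        · simp
        · by_cases h' : m = n + 1
          · subst h'
            simp [Finset.prod_range_succ, show n + 1 + 1 ≠ n by omega]
            ring
          · simp [h.ne', h', show m + 1 ≠ n by omega]

end ThreeTerm

/-! ### Moments -/

/-- The functional `p ↦ (G⁻¹ p)(0)`. -/
noncomputable def momentFunctional (G : Module.End ℂ (Polynomial ℂ)) : Polynomial ℂ →ₗ[ℂ] ℂ :=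
  (Polynomial.lcoeff ℂ 0).comp (Ring.inverse G)

theorem momentFunctional_apply {G : Module.End ℂ (Polynomial ℂ)} (hG : IsUnit G)
    (p : Polynomial ℂ) : momentFunctional G (G p) = p.coeff 0 := by
  have h := LinearMap.congr_fun (Ring.inverse_mul_cancel G hG) p
  rw [Module.End.mul_apply, Module.End.one_apply] at h
  rw [momentFunctional, LinearMap.comp_apply, h, Polynomial.lcoeff_apply]

theorem coeff_momentSeries (G : Module.End ℂ (Polynomial ℂ)) (n : ℕ) :
    PowerSeries.coeff n (momentSeries G) =
      momentFunctional G (Polynomial.X ^ n) / n.factorial := by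
  rw [momentSeries, bar, PowerSeries.coeff_mk, seriesD_eq_sheffer, sheffer_one_X,
    Module.End.one_apply, ← Polynomial.coeff_zero_eq_eval_zero]
  rfl

theorem pairing_momentSeries (G : Module.End ℂ (Polynomial ℂ)) (p q : Polynomial ℂ) :
    pairing (momentSeries G) p q = momentFunctional G (p * q) := by
  rw [pairing, ← Polynomial.coeff_zero_eq_eval_zero]
  refine LinearMap.congr_fun (f := (Polynomial.lcoeff ℂ 0).comp (seriesD (momentSeries G)))
    (functional_ext fun n => ?_) (p * q)
  rw [LinearMap.comp_apply, Polynomial.lcoeff_apply, coeff_seriesD, if_pos n.zero_le, Nat.sub_zero,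
    coeff_momentSeries, Nat.factorial_zero, Nat.cast_one, div_one]
  have : (n.factorial : ℂ) ≠ 0 := by exact_mod_cast n.factorial_ne_zero
  field_simp

theorem diagSeries_factorial_momentSeries (G : Module.End ℂ (Polynomial ℂ)) :
    diagSeries (fun n => (n.factorial : ℂ)) (momentSeries G) =
      PowerSeries.mk fun n => momentFunctional G (Polynomial.X ^ n) := by
  ext n
  rw [diagSeries, PowerSeries.coeff_mk, PowerSeries.coeff_mk, coeff_momentSeries]
  have : (n.factorial : ℂ) ≠ 0 := by exact_mod_cast n.factorial_ne_zero
  field_simp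

/-! ### The associated Jacobi operator -/

section Jacobi

variable {a lam kap bet r c : ℂ}

/-- The shifted Jacobi operator: the associated Jacobi operator without its factor on the left. -/
noncomputable def jacobiShifted (a lam kap bet c : ℂ) : Module.End ℂ (Polynomial ℂ) :=
  opOf (jacobiRow a lam kap bet c)

theorem jacobiShifted_X_pow (n : ℕ) :
    jacobiShifted a lam kap bet c (Polynomial.X ^ n) = jacobiRow a lam kap bet c n :=
  opOf_X_pow _ _

theorem isUnit_jacobiShifted (H : Admissible lam kap bet r c) :
    IsUnit (jacobiShifted a lam kap bet c) := by
  refine isUnit_of_degree fun n => ?_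
  rw [jacobiShifted_X_pow]
  refine Polynomial.degree_eq_of_le_of_coeff_ne_zero ?_ ?_
  · refine (Polynomial.degree_le_iff_coeff_zero _ _).2 fun k hk => ?_
    rw [coeff_jacobiRow, jacobiEntry_of_lt (Nat.cast_lt.1 hk)]
  · rw [coeff_jacobiRow, jacobiEntry_self H]
    exact one_ne_zero

theorem assocJacobiG_eq (H : Admissible lam kap bet r c) : assocJacobiG a lam kap bet c =
    seriesShift (jacobiK a lam kap bet c) * jacobiShifted a lam kap bet c := by
  rw [assocJacobiG, diag_factorial_mul_seriesD]
  simp only [mul_assoc]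
  congr 1
  refine end_ext fun n => Polynomial.ext fun k => ?_
  rw [jacobiShifted_X_pow, coeff_jacobiRow, ← mul_assoc (seriesD _),
    ← mul_assoc (Ring.inverse _), ← mul_assoc (Ring.inverse _), ← jacobiCore]
  simp only [Module.End.mul_apply, coeff_diag, diag_X_pow, map_smul, Polynomial.coeff_smul,
    coeff_jacobiCore, smul_eq_mul, jacobiEntry]
  split_ifs
  · have h₁ := H.fall_ne_zero n
    have h₂ := H.fall_ne_zero k
    have h₃ := H.jacobiF_ne_zero n
    have h₄ := H.jacobiF_ne_zero k
    have h₅ : (n.factorial : ℂ) ≠ 0 := by exact_mod_cast n.factorial_ne_zero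
    have h₆ : (k.factorial : ℂ) ≠ 0 := by exact_mod_cast k.factorial_ne_zero
    rw [jacobiWeight, jacobiWeight]
    field_simp
  · simp

/-- `(c + k)_{k+1} = c (c + k)_k`: splitting off the factors of index `c - 1` leaves exactly the
weight `w_k`, which cancels the denominator of `jacobiEntry`. -/
theorem coeff_jacobiK_succ (k : ℕ) :
    PowerSeries.coeff (k + 1) (jacobiK a lam kap bet c) =
      c * jacobiRatio lam kap bet (c - 1) * jacobiWeight lam kap bet c k *
        PowerSeries.coeff (k + 1) (cpow (jacobiW a lam) (c - 1 + 1 / lam)) := by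
  rw [jacobiK, diagSeries, PowerSeries.coeff_mk, jacobiF_pred_succ,
    show c + ((k + 1 : ℕ) : ℂ) - 1 = c + k by push_cast; ring, fall_add_self, jacobiWeight]
  ring

theorem constantCoeff_jacobiK : PowerSeries.constantCoeff (jacobiK a lam kap bet c) = 1 := by
  rw [← PowerSeries.coeff_zero_eq_constantCoeff_apply, jacobiK, diagSeries, PowerSeries.coeff_mk,
    PowerSeries.coeff_zero_eq_constantCoeff_apply, constantCoeff_cpow (constantCoeff_jacobiW a lam)]
  simp [fall, jacobiF]

/-- After the weights cancel, the left side is `c ρ(c - 1) w_n` times the sum of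
`sum_coeff_cpow_jacobiW` for `u = c - 1` and order `n + 1`, without its term `j = 0`. The full sum
vanishes, and the missing term is the boundary entry. -/
theorem seriesShift_boundary (H : Admissible lam kap bet r c) (n : ℕ) :
    (seriesShift (jacobiK a lam kap bet c) (Polynomial.X * jacobiRow a lam kap bet c n)).coeff 0 =
      -jacobiBoundary a lam kap bet c n := by
  have h := sum_coeff_cpow_jacobiW a lam (c - 1) (n + 1)
  rw [if_neg (Nat.succ_ne_zero n), Finset.sum_range_succ', Nat.cast_zero, zero_add, Nat.sub_zero,
    PowerSeries.coeff_zero_eq_constantCoeff_apply, constantCoeff_cpow (constantCoeff_jacobiW a lam),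
    one_mul] at h
  have hX : Polynomial.X * jacobiRow a lam kap bet c n = ∑ k ∈ Finset.range (n + 1),
      jacobiEntry a lam kap bet c n k • Polynomial.X ^ (k + 1) := by
    rw [jacobiRow, Finset.mul_sum]
    refine Finset.sum_congr rfl fun k _ => ?_
    rw [Polynomial.smul_eq_C_mul]
    ring
  rw [hX, map_sum, Polynomial.finsetSum_coeff, jacobiBoundary, eq_neg_iff_add_eq_zero]
  have key : ∀ k ∈ Finset.range (n + 1), (seriesShift (jacobiK a lam kap bet c)
      (jacobiEntry a lam kap bet c n k • Polynomial.X ^ (k + 1))).coeff 0 =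
      c * jacobiRatio lam kap bet (c - 1) * jacobiWeight lam kap bet c n *
        (PowerSeries.coeff (k + 1) (cpow (jacobiW a lam) (c - 1 + 1 / lam)) *
          jacobiBinom a lam ((k + 1 : ℕ) + (c - 1)) (n + 1 - (k + 1))) := by
    intro k hk
    have hk0 := H.jacobiWeight_ne_zero k
    rw [map_smul, Polynomial.coeff_smul, coeff_seriesShift, if_pos (Nat.zero_le _), Nat.sub_zero,
      coeff_jacobiK_succ, jacobiEntry, if_pos (by simp at hk; omega), smul_eq_mul,
      Nat.add_sub_add_right, show ((k + 1 : ℕ) : ℂ) + (c - 1) = k + c by push_cast; ring]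
    field_simp
  rw [Finset.sum_congr rfl key, ← Finset.mul_sum, ← mul_add, h, mul_zero]

theorem mulX_mul_assocJacobiG (H : Admissible lam kap bet r c) :
    mulX * assocJacobiG a lam kap bet c = assocJacobiG a lam kap bet c *
      assocDualRaising (jacobiA a lam kap r) (jacobiB a lam kap bet r) c := by
  rw [assocJacobiG_eq H]
  refine end_ext fun n => ?_
  have h := seriesShift_X_mul (jacobiK a lam kap bet c) (jacobiRow a lam kap bet c n)
  rw [seriesShift_boundary H] at h
  simp only [Module.End.mul_apply, mulX, LinearMap.mulLeft_apply, jacobiShifted_X_pow]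
  rcases n with _ | n
  · rw [assocDualRaising_X_pow_zero, map_add, map_smul, jacobiShifted_X_pow, jacobiShifted_X_pow,
      map_add, map_smul]
    rw [X_mul_jacobiRow_zero H, map_sub, map_add, seriesShift_C constantCoeff_jacobiK,
      ← Polynomial.smul_eq_C_mul, map_smul, map_neg] at h
    linear_combination -h
  · simp only [assocDualRaising_X_pow_succ, map_add, map_smul, jacobiShifted_X_pow]
    rw [X_mul_jacobiRow_succ H, map_sub, map_add, map_add, seriesShift_C constantCoeff_jacobiK,
      ← Polynomial.smul_eq_C_mul, ← Polynomial.smul_eq_C_mul, map_smul, map_smul, map_neg] at h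
    linear_combination -h

theorem assocJacobiG_X_pow (H : Admissible lam kap bet r c) (n : ℕ) :
    assocJacobiG a lam kap bet c (Polynomial.X ^ n) =
      assocPoly (jacobiA a lam kap r) (jacobiB a lam kap bet r) c n := by
  refine apply_X_pow_eq_assocPoly ?_ (mulX_mul_assocJacobiG H) n
  rw [assocJacobiG_eq H, Module.End.mul_apply, jacobiShifted_X_pow, jacobiRow_zero H,
    ← map_one Polynomial.C,
    seriesShift_C constantCoeff_jacobiK]

theorem isUnit_assocJacobiG (H : Admissible lam kap bet r c) :
    IsUnit (assocJacobiG a lam kap bet c) :=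
  isUnit_of_assocPoly (assocJacobiG_X_pow H)

theorem inverse_mul_mulX_mul_assocJacobiG (H : Admissible lam kap bet r c) :
    Ring.inverse (assocJacobiG a lam kap bet c) * mulX * assocJacobiG a lam kap bet c =
      assocDualRaising (jacobiA a lam kap r) (jacobiB a lam kap bet r) c := by
  rw [mul_assoc, mulX_mul_assocJacobiG H, ← mul_assoc,
    Ring.inverse_mul_cancel _ (isUnit_assocJacobiG H), one_mul]

theorem pairing_assocJacobiG (H : Admissible lam kap bet r c) (m n : ℕ) :
    pairing (momentSeries (assocJacobiG a lam kap bet c))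
      (assocJacobiG a lam kap bet c (Polynomial.X ^ m))
      (assocJacobiG a lam kap bet c (Polynomial.X ^ n)) =
        if m = n then ∏ j ∈ Finset.range n, (j + 1 + c) * jacobiB a lam kap bet r (j + 1 + c)
        else 0 := by
  rw [pairing_momentSeries, assocJacobiG_X_pow H, assocJacobiG_X_pow H]
  refine assocPoly_orthogonal (fun k => ?_) m n
  rw [← assocJacobiG_X_pow H, momentFunctional_apply (isUnit_assocJacobiG H),
    Polynomial.coeff_X_pow]
  simp only [eq_comm]

theorem coeff_jacobiN (n : ℕ) : PowerSeries.coeff n (jacobiN a lam kap bet c) =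
    jacobiWeight lam kap bet c n *
      PowerSeries.coeff n (cpow (jacobiW a lam) (c + 1 / lam)) := by
  rw [jacobiN, diagSeries, PowerSeries.coeff_mk, jacobiWeight]

theorem momentFunctional_seriesShift (H : Admissible lam kap bet r c) (n : ℕ) :
    momentFunctional (assocJacobiG a lam kap bet c)
      (seriesShift (jacobiK a lam kap bet c) (Polynomial.X ^ n)) =
        PowerSeries.coeff n (jacobiN a lam kap bet c) := by
  let ν : Polynomial ℂ →ₗ[ℂ] ℂ := (Polynomial.basisMonomials ℂ).constr ℂ
    fun n => PowerSeries.coeff n (jacobiN a lam kap bet c)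
  have hν : ∀ n : ℕ, ν (Polynomial.X ^ n) = PowerSeries.coeff n (jacobiN a lam kap bet c) := by
    intro n
    rw [show (Polynomial.X ^ n : Polynomial ℂ) = Polynomial.basisMonomials ℂ n by
      simp [Polynomial.coe_basisMonomials, Polynomial.X_pow_eq_monomial]]
    exact Module.Basis.constr_basis _ _ _ _
  have hM : (momentFunctional (assocJacobiG a lam kap bet c)).comp
      (seriesShift (jacobiK a lam kap bet c) * jacobiShifted a lam kap bet c) =
      ν.comp (jacobiShifted a lam kap bet c) := by
    refine functional_ext fun n => ?_
    rw [← assocJacobiG_eq H, LinearMap.comp_apply, LinearMap.comp_apply,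
      momentFunctional_apply (isUnit_assocJacobiG H), jacobiShifted_X_pow, jacobiRow, map_sum,
      Polynomial.coeff_X_pow]
    have h := sum_coeff_cpow_jacobiW a lam c n
    simp only [eq_comm (a := (0 : ℕ)), ← Polynomial.smul_eq_C_mul, map_smul, hν, smul_eq_mul,
      coeff_jacobiN]
    -- The weight may be inserted because `w_0 = 1`.
    have hw : (if n = 0 then (1 : ℂ) else 0) =
        jacobiWeight lam kap bet c n * if n = 0 then (1 : ℂ) else 0 := by
      split_ifs with hn
      · rw [hn, jacobiWeight_zero, mul_one]
      · simp
    rw [hw, ← h, Finset.mul_sum]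
    refine Finset.sum_congr rfl fun k hk => ?_
    have hk0 := H.jacobiWeight_ne_zero k
    rw [jacobiEntry, if_pos (by simp at hk; omega)]
    field_simp
  -- The shifted operator is onto, so it can be cancelled on the right of `hM`.
  obtain ⟨p, hp⟩ := ((Module.End.isUnit_iff _).1 (isUnit_jacobiShifted (a := a) H)).2
    (Polynomial.X ^ n)
  have h := LinearMap.congr_fun hM p
  rw [LinearMap.comp_apply, LinearMap.comp_apply, Module.End.mul_apply, hp, hν] at h
  exact h

theorem laplace_momentSeries_mul (H : Admissible lam kap bet r c) :
    diagSeries (fun n => (n.factorial : ℂ)) (momentSeries (assocJacobiG a lam kap bet c)) *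
      jacobiK a lam kap bet c = jacobiN a lam kap bet c := by
  rw [diagSeries_factorial_momentSeries]
  ext n
  rw [← momentFunctional_seriesShift H, seriesShift, opOf_X_pow, map_sum, PowerSeries.coeff_mul,
    Finset.Nat.sum_antidiagonal_eq_sum_range_succ_mk]
  refine Finset.sum_congr rfl fun j _ => ?_
  rw [← Polynomial.smul_eq_C_mul, map_smul, PowerSeries.coeff_mk, smul_eq_mul, mul_comm]

theorem laplace_momentSeries (H : Admissible lam kap bet r c) :
    diagSeries (fun n => (n.factorial : ℂ)) (momentSeries (assocJacobiG a lam kap bet c)) =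
      jacobiN a lam kap bet c * (jacobiK a lam kap bet c)⁻¹ := by
  rw [← laplace_momentSeries_mul H, mul_assoc, PowerSeries.mul_inv_cancel _
    (by rw [constantCoeff_jacobiK]; exact one_ne_zero), mul_one]

/-! ### The Jacobi family as the case `c = 0` -/

/-- At `c = 0` all coefficients of `K` of positive order carry the factor `c`, so `K = 1`; moreover
`(n)_n = n!`, so the extra diagonal factors cancel the factorials. -/
theorem jacobiG_eq (H : Admissible lam kap bet r 0) :
    jacobiG a lam kap bet = assocJacobiG a lam kap bet 0 := by
  have hK : seriesShift (jacobiK a lam kap bet 0) = 1 := by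
    refine end_ext fun n => Polynomial.ext fun k => ?_
    rw [coeff_seriesShift, Module.End.one_apply, Polynomial.coeff_X_pow]
    rcases lt_trichotomy k n with h | rfl | h
    · obtain ⟨d, rfl⟩ := Nat.exists_eq_add_of_lt h
      rw [show k + d + 1 - k = d + 1 by omega, coeff_jacobiK_succ, if_neg h.ne]
      simp
    · simp [constantCoeff_jacobiK]
    · rw [if_neg (by omega), if_neg (by omega)]
  rw [assocJacobiG_eq H, hK, one_mul]
  refine end_ext fun n => Polynomial.ext fun k => ?_
  rw [jacobiShifted_X_pow, coeff_jacobiRow, jacobiG,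
    show -(1 / lam) = -0 - 1 / lam by ring]
  simp only [mul_assoc]
  rw [← mul_assoc (seriesD _), ← mul_assoc (Ring.inverse _), ← mul_assoc (Ring.inverse _),
    ← jacobiCore]
  simp only [Module.End.mul_apply, coeff_diag, diag_X_pow, map_smul, Polynomial.coeff_smul,
    coeff_jacobiCore, smul_eq_mul, jacobiEntry]
  have hf : ∀ n : ℕ, fall (0 + n) n = n.factorial := by
    intro n
    induction n with
    | zero => simp [fall]
    | succ n ih => rw [fall_succ_shift, ih, Nat.factorial_succ]; push_cast; ring
  split_ifs
  · have h₃ := H.jacobiF_ne_zero n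
    have h₄ := H.jacobiF_ne_zero k
    have h₆ : (k.factorial : ℂ) ≠ 0 := by exact_mod_cast k.factorial_ne_zero
    rw [jacobiWeight, jacobiWeight, hf, hf]
    field_simp
  · simp

theorem assocDualRaising_zero (A B : ℂ → ℂ) :
    assocDualRaising A B 0 = mulX + diag (fun n => A n) + opD * diag (fun n => B n) := by
  refine end_ext fun n => ?_
  simp only [LinearMap.add_apply, Module.End.mul_apply, mulX, opD, LinearMap.mulLeft_apply,
    diag_X_pow]
  rcases n with _ | n
  · rw [assocDualRaising_X_pow_zero]
    simp
  · rw [assocDualRaising_X_pow_succ, map_smul, Polynomial.derivative_X_pow, Nat.add_sub_cancel,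
      ← Polynomial.smul_eq_C_mul, smul_smul, ← pow_succ', mul_comm (B _)]
    push_cast
    simp only [add_zero]

end Jacobi

/-! ### The coefficients of the powers of `f'(ω)` -/

theorem choose_mul_factorial (s : ℂ) (n : ℕ) :
    Ring.choose s n * n.factorial = ∏ i ∈ Finset.range n, (s - i) := by
  induction n with
  | zero => simp
  | succ n ih =>
    have h := choose_succ_mul s n
    rw [Finset.prod_range_succ, ← ih, Nat.factorial_succ]
    push_cast
    linear_combination (n.factorial : ℂ) * h

theorem choose_neg_mul_factorial (s : ℂ) (n : ℕ) :
    Ring.choose (-s) n * n.factorial = (-1) ^ n * ∏ i ∈ Finset.range n, (s + i) := by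
  rw [choose_mul_factorial]
  conv_rhs => rw [← Finset.card_range n, ← Finset.prod_const, Finset.card_range,
    ← Finset.prod_mul_distrib]
  exact Finset.prod_congr rfl fun i _ => by ring

/-- The `n`-th finite difference of a polynomial of degree `n - 1` vanishes. -/
theorem sum_choose_mul_prod (s : ℂ) (n : ℕ) :
    ∑ k ∈ Finset.range (n + 2), (-1 : ℂ) ^ (n + 1 - k) * (n + 1).choose k *
      ∏ i ∈ Finset.range n, (s + k + (1 + i)) = 0 := by
  let P : Polynomial ℂ := ∏ i ∈ Finset.range n, (Polynomial.X + Polynomial.C (1 + (i : ℂ)))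
  have hP : P.natDegree < n + 1 := by
    rw [Polynomial.natDegree_prod_of_monic _ _ fun i _ => Polynomial.monic_X_add_C _,
      Finset.sum_congr rfl fun i _ => Polynomial.natDegree_X_add_C _]
    simp
  have h := congrFun (Polynomial.fwdDiff_iter_eq_zero_of_degree_lt hP) s
  rw [fwdDiff_iter_eq_sum_shift] at h
  simpa [P, Polynomial.eval_prod] using h

/-- The coefficient `(s / (2 n + s)) (2 n + s choose n)`, times `n!`. -/
noncomputable def ballot (s : ℂ) : ℕ → ℂ
  | 0 => 1
  | n + 1 => s * ∏ i ∈ Finset.range n, (s + (n + 1) + (1 + i))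

/-- The factors of the ballot number end where those of the rising product begin. Together they form
one run of `n` consecutive factors, a polynomial of degree `n` in `k`. -/
theorem ballot_mul_prod (s : ℂ) (n k : ℕ) (hk : k ≤ n + 1) :
    ballot s k * ∏ i ∈ Finset.range (n + 1 - k), (s + 2 * k + i) =
      s * ∏ i ∈ Finset.range n, (s + k + (1 + i)) := by
  cases k with
  | zero =>
    rw [ballot, Nat.sub_zero, Finset.prod_range_succ', one_mul, mul_comm]
    congr 1
    · simp
    · exact Finset.prod_congr rfl fun i _ => by push_cast; ring
  | succ k =>
    obtain ⟨d, rfl⟩ := Nat.exists_eq_add_of_le (Nat.succ_le_succ_iff.1 hk)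
    rw [ballot, Finset.prod_range_add, show k + d + 1 - (k + 1) = d by omega, mul_assoc]
    congr 2
    · exact Finset.prod_congr rfl fun i _ => by push_cast; ring
    · exact Finset.prod_congr rfl fun i _ => by push_cast; ring

theorem jacobiBinom_mul_factorial (a lam u : ℂ) (n : ℕ) :
    jacobiBinom a lam u n * n.factorial = (-1) ^ n *
      (∏ i ∈ Finset.range n, (2 * u + 2 / lam + i)) * (lam * a / 2) ^ n := by
  rw [jacobiBinom, mul_right_comm, show -2 * u - 2 / lam = -(2 * u + 2 / lam) by ring,
    choose_neg_mul_factorial]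

/-- Multiplied by `(n + 1)!`, the sum is an `(n + 1)`-st finite difference of a polynomial of degree
`n`. Ballot numbers thus solve the triangular system of `sum_coeff_cpow_jacobiW`. -/
theorem sum_ballot (a lam u : ℂ) (n : ℕ) :
    ∑ k ∈ Finset.range (n + 2), ballot (2 * u + 2 / lam) k / k.factorial * (lam * a / 2) ^ k *
      jacobiBinom a lam (k + u) (n + 1 - k) = 0 := by
  have h := sum_choose_mul_prod (2 * u + 2 / lam) n
  have hn : ((n + 1).factorial : ℂ) ≠ 0 := by exact_mod_cast (n + 1).factorial_ne_zero
  refine (mul_right_inj' hn).1 ?_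
  rw [mul_zero, ← mul_zero ((2 * u + 2 / lam) * (lam * a / 2) ^ (n + 1)), ← h, Finset.mul_sum,
    Finset.mul_sum]
  refine Finset.sum_congr rfl fun k hk => ?_
  have hk' : k ≤ n + 1 := by simp at hk; omega
  have h₁ := ballot_mul_prod (2 * u + 2 / lam) n k hk'
  have h₂ := jacobiBinom_mul_factorial a lam (k + u) (n + 1 - k)
  have h₃ : ((n + 1).choose k * k.factorial * (n + 1 - k).factorial : ℂ) = (n + 1).factorial := by
    exact_mod_cast Nat.choose_mul_factorial_mul_factorial hk'
  have hk₀ : (k.factorial : ℂ) ≠ 0 := by exact_mod_cast k.factorial_ne_zero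
  have ht : (lam * a / 2) ^ (n + 1) = (lam * a / 2) ^ k * (lam * a / 2) ^ (n + 1 - k) := by
    rw [← pow_add, Nat.add_sub_cancel' hk']
  rw [show 2 * ((k : ℂ) + u) + 2 / lam = 2 * u + 2 / lam + 2 * k by ring] at h₂
  rw [← h₃, ht]
  generalize 2 * u + 2 / lam = s at *
  field_simp
  linear_combination (ballot s k * (lam * a / 2) ^ k * (n + 1).choose k) * h₂ +
    ((lam * a / 2) ^ k * (lam * a / 2) ^ (n + 1 - k) * (-1) ^ (n + 1 - k) * (n + 1).choose k) * h₁

theorem coeff_cpow_jacobiW (a lam u : ℂ) (n : ℕ) :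
    PowerSeries.coeff n (cpow (jacobiW a lam) (u + 1 / lam)) =
      ballot (2 * u + 2 / lam) n / n.factorial * (lam * a / 2) ^ n := by
  induction n using Nat.strong_induction_on with
  | _ n ih =>
    cases n with
    | zero =>
      simp [constantCoeff_cpow (constantCoeff_jacobiW a lam), ballot]
    | succ n =>
      have h₁ := sum_coeff_cpow_jacobiW a lam u (n + 1)
      have h₂ := sum_ballot a lam u n
      rw [if_neg (Nat.succ_ne_zero n), Finset.sum_range_succ, Nat.sub_self, jacobiBinom_zero,
        mul_one] at h₁
      rw [Finset.sum_range_succ, Nat.sub_self, jacobiBinom_zero, mul_one] at h₂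
      rw [Finset.sum_congr rfl fun k hk => by rw [ih k (Finset.mem_range.1 hk)]] at h₁
      linear_combination h₁ - h₂

/-! ### Gamma quotients and hypergeometric series -/

section Hypergeometric

variable {a lam kap bet r c : ℂ}

theorem two_div_kap (hlk : 1 / kap - 1 / lam = 1 / 2) : 2 / kap = 2 / lam + 1 := by
  linear_combination 2 * hlk

/-- Because `2/κ = 2/λ + 1`, the two denominators of `ρ` are proportional to consecutive numbers.
Hence a single `Γ` of doubled argument accounts for both. -/
theorem jacobiRatio_eq {z : ℂ} (hlam : lam ≠ 0) (hkap : kap ≠ 0)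
    (hlk : 1 / kap - 1 / lam = 1 / 2) (hbet : bet ≠ 0) (h₁ : 1 + lam * z ≠ 0)
    (h₂ : 1 + kap * z ≠ 0) :
    (2 * z + 2 / lam) * (2 * z + 2 / lam + 1) * jacobiRatio lam kap bet z =
      4 * bet / (lam * kap) * (z + 1 / bet) := by
  rw [add_assoc, ← two_div_kap hlk, jacobiRatio]
  have e₁ : 2 * z + 2 / lam = 2 / lam * (1 + lam * z) := by field_simp; ring
  have e₂ : 2 * z + 2 / kap = 2 / kap * (1 + kap * z) := by field_simp; ring
  have e₃ : z + 1 / bet = 1 / bet * (1 + bet * z) := by field_simp; ring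
  rw [e₁, e₂, e₃]
  generalize 1 + lam * z = x at *
  generalize 1 + kap * z = y at *
  field_simp
  ring

/-- Even `m` corresponds to the factors with `λ`, odd `m` to those with `κ`. -/
theorem Admissible.two_mul_add_ne (H : Admissible lam kap bet r c) (m : ℕ) :
    2 * c + 2 / lam + m ≠ 0 := by
  obtain ⟨j, rfl | rfl⟩ := Nat.even_or_odd' m
  · have h := (H.factor_ne j).1
    have hl := H.lam_ne
    intro h0
    refine h ?_
    have : 1 + lam * (c + j) = lam / 2 * (2 * c + 2 / lam + (2 * j : ℕ)) := by
      push_cast; field_simp; ring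
    rw [this, h0, mul_zero]
  · have h := (H.factor_ne j).2.1
    have hl := H.kap_ne
    intro h0
    refine h ?_
    have : 1 + kap * (c + j) = kap / 2 * (2 * c + 2 / kap + (2 * j : ℕ)) := by
      push_cast; field_simp; ring
    rw [this, two_div_kap H.inv_sub_inv, show 2 * c + (2 / lam + 1) + ((2 * j : ℕ) : ℂ) =
      2 * c + 2 / lam + (2 * j + 1 : ℕ) by push_cast; ring, h0, mul_zero]

theorem Admissible.add_one_div_bet_ne (H : Admissible lam kap bet r c) (hbet : bet ≠ 0) (m : ℕ) :
    m + c + 1 / bet ≠ 0 := by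
  have h := (H.factor_ne m).2.2
  intro h0
  refine h ?_
  have : 1 + bet * (c + m) = bet * (m + c + 1 / bet) := by field_simp; ring
  rw [this, h0, mul_zero]

theorem jacobiF_eq_Gamma (H : Admissible lam kap bet r c) (hbet : bet ≠ 0) (n : ℕ) :
    jacobiF lam kap bet c n = (4 * bet / (lam * kap)) ^ n *
      (Complex.Gamma (2 * c + 2 / lam) / Complex.Gamma (2 * (n + c) + 2 / lam)) *
      (Complex.Gamma (n + c + 1 / bet) / Complex.Gamma (c + 1 / bet)) := by
  have hne : ∀ n : ℕ, Complex.Gamma (2 * (n + c) + 2 / lam) ≠ 0 := by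
    intro n
    refine Complex.Gamma_ne_zero fun m h => H.two_mul_add_ne (2 * n + m) ?_
    push_cast
    linear_combination h
  induction n with
  | zero =>
    have h₁ := hne 0
    have h₂ : Complex.Gamma (c + 1 / bet) ≠ 0 := by
      refine Complex.Gamma_ne_zero fun m h => H.add_one_div_bet_ne hbet m ?_
      linear_combination h
    simp only [Nat.cast_zero, zero_add] at h₁ ⊢
    rw [div_self h₁, div_self h₂]
    simp [jacobiF]
  | succ n ih =>
    have h₀ := H.two_mul_add_ne (2 * n)
    have h₁ := H.two_mul_add_ne (2 * n + 1)
    have h₂ := H.add_one_div_bet_ne hbet n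
    have hG := hne n
    push_cast at h₀ h₁
    rw [show 2 * c + 2 / lam + 2 * (n : ℂ) = 2 * (n + c) + 2 / lam by ring] at h₀
    rw [show 2 * c + 2 / lam + (2 * (n : ℂ) + 1) = 2 * (n + c) + 2 / lam + 1 by ring] at h₁
    have hf := H.factor_ne n
    have hR := jacobiRatio_eq H.lam_ne H.kap_ne H.inv_sub_inv hbet hf.1 hf.2.1
    rw [add_comm c (n : ℂ)] at hR
    rw [jacobiF_succ, ih, show 2 * (((n + 1 : ℕ) : ℂ) + c) + 2 / lam =
      2 * (n + c) + 2 / lam + 1 + 1 by push_cast; ring, Complex.Gamma_add_one _ h₁,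
      Complex.Gamma_add_one _ h₀, show ((n + 1 : ℕ) : ℂ) + c + 1 / bet = n + c + 1 / bet + 1 by
      push_cast; ring, Complex.Gamma_add_one _ h₂, add_comm c (n : ℂ), pow_succ]
    have hR' : jacobiRatio lam kap bet (n + c) = 4 * bet / (lam * kap) * (n + c + 1 / bet) /
        ((2 * (n + c) + 2 / lam) * (2 * (n + c) + 2 / lam + 1)) := by
      rw [eq_div_iff (mul_ne_zero h₀ h₁), ← hR]
      ring
    rw [hR']
    generalize (4 * bet / (lam * kap)) = q
    generalize 2 * (n + c) + 2 / lam = x at *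
    generalize (n + c + 1 / bet) = y
    field_simp

theorem ascPochhammer_eval_eq_prod (z : ℂ) (n : ℕ) :
    (ascPochhammer ℂ n).eval z = ∏ j ∈ Finset.range n, (z + j) := by
  induction n with
  | zero => simp
  | succ n ih => rw [ascPochhammer_succ_eval, ih, Finset.prod_range_succ]

theorem fall_eq_prod (z : ℂ) (n : ℕ) :
    fall (z + n) n = ∏ j ∈ Finset.range n, (z + 1 + j) := by
  induction n with
  | zero => simp [fall]
  | succ n ih => rw [fall_succ_shift, ih, Finset.prod_range_succ]; ring

/-- Both sides are the rising product `s (s + 1) ⋯ (s + 2n - 1)`, on the right grouped in pairs. -/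
theorem ballot_mul_prod_succ (s : ℂ) (n : ℕ) :
    ballot s n * ∏ j ∈ Finset.range n, (s + 1 + j) =
      ∏ j ∈ Finset.range n, ((s + 2 * j) * (s + 2 * j + 1)) := by
  have h : ∏ j ∈ Finset.range n, ((s + 2 * j) * (s + 2 * j + 1)) =
      ∏ i ∈ Finset.range (2 * n), (s + i) := by
    induction n with
    | zero => simp
    | succ n ih =>
      rw [Finset.prod_range_succ, ih, show 2 * (n + 1) = 2 * n + 1 + 1 by ring,
        Finset.prod_range_succ, Finset.prod_range_succ]
      push_cast
      ring
  rw [h]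
  cases n with
  | zero => simp [ballot]
  | succ n =>
    have h₁ : ∏ x ∈ Finset.range (n + 1), (s + ((x + 1 : ℕ) : ℂ)) =
        ∏ x ∈ Finset.range (n + 1), (s + 1 + x) :=
      Finset.prod_congr rfl fun x _ => by push_cast; ring
    have h₂ : ∏ x ∈ Finset.range n, (s + ((n + 1 + x + 1 : ℕ) : ℂ)) =
        ∏ x ∈ Finset.range n, (s + (n + 1) + (1 + x)) :=
      Finset.prod_congr rfl fun x _ => by push_cast; ring
    rw [ballot, show 2 * (n + 1) = (n + 1 + n) + 1 by ring,
      Finset.prod_range_succ' (fun i : ℕ => s + (i : ℂ)) (n + 1 + n),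
      Finset.prod_range_add (fun i : ℕ => s + ((i + 1 : ℕ) : ℂ)), h₁, h₂, Nat.cast_zero, add_zero]
    ring

/-- The denominators of the `ρ` factors multiply to the ballot number times `(s + 1) ⋯ (s + n)` with
`s = 2u + 2/λ`. The ballot number cancels the one in the coefficient of the power of `f'(ω)`, and `s
+ 1 = 2u + 2/κ`. -/
theorem jacobiF_mul_coeff_cpow {u : ℂ} (hlam : lam ≠ 0) (hkap : kap ≠ 0)
    (hlk : 1 / kap - 1 / lam = 1 / 2) (hbet : bet ≠ 0)
    (hu : ∀ j : ℕ, 1 + lam * (u + j) ≠ 0 ∧ 1 + kap * (u + j) ≠ 0) (n : ℕ) :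
    jacobiF lam kap bet u n * PowerSeries.coeff n (cpow (jacobiW a lam) (u + 1 / lam)) =
      (2 * bet * a / kap) ^ n * ((n.factorial : ℂ)⁻¹ *
        (∏ j ∈ Finset.range n, (u + 1 / bet + j)) *
          (∏ j ∈ Finset.range n, (2 * u + 2 / kap + j))⁻¹) := by
  have hne : ∏ j ∈ Finset.range n, (2 * u + 2 / kap + j) ≠ 0 := by
    refine Finset.prod_ne_zero_iff.2 fun m _ => ?_
    obtain ⟨j, rfl | rfl⟩ := Nat.even_or_odd' m
    · have : 2 * u + 2 / kap + ((2 * j : ℕ) : ℂ) = 2 / kap * (1 + kap * (u + j)) := by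
        push_cast; field_simp; ring
      rw [this]
      exact mul_ne_zero (div_ne_zero two_ne_zero hkap) (hu j).2
    · have : 2 * u + 2 / kap + ((2 * j + 1 : ℕ) : ℂ) =
          2 / lam * (1 + lam * (u + (j + 1 : ℕ))) := by
        rw [two_div_kap hlk]
        push_cast; field_simp; ring
      rw [this]
      exact mul_ne_zero (div_ne_zero two_ne_zero hlam) (hu (j + 1)).1
  have hn : (n.factorial : ℂ) ≠ 0 := by exact_mod_cast n.factorial_ne_zero
  have h₁ : jacobiF lam kap bet u n * ∏ j ∈ Finset.range n,
      ((2 * u + 2 / lam + 2 * j) * (2 * u + 2 / lam + 2 * j + 1)) =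
      (4 * bet / (lam * kap)) ^ n * ∏ j ∈ Finset.range n, (u + 1 / bet + j) := by
    rw [jacobiF, ← Finset.prod_mul_distrib, ← Finset.card_range n, ← Finset.prod_const,
      Finset.card_range, ← Finset.prod_mul_distrib]
    refine Finset.prod_congr rfl fun j _ => ?_
    have h := jacobiRatio_eq hlam hkap hlk hbet (hu j).1 (hu j).2
    rw [show 2 * (u + j) + 2 / lam = 2 * u + 2 / lam + 2 * (j : ℂ) by ring] at h
    rw [mul_comm, h]
    ring
  rw [← ballot_mul_prod_succ] at h₁
  have hp : 2 * bet * a / kap = 4 * bet / (lam * kap) * (lam * a / 2) := by field_simp; ring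
  rw [coeff_cpow_jacobiW, hp, mul_pow]
  have he : ∀ j : ℕ, 2 * u + 2 / kap + (j : ℂ) = 2 * u + 2 / lam + 1 + j := fun j => by
    rw [two_div_kap hlk]; ring
  simp only [he] at hne ⊢
  generalize (4 * bet / (lam * kap)) ^ n = q at *
  generalize ∏ j ∈ Finset.range n, (2 * u + 2 / lam + 1 + (j : ℂ)) = y at *
  generalize ∏ j ∈ Finset.range n, (u + 1 / bet + (j : ℂ)) = x at *
  generalize ballot (2 * u + 2 / lam) n = b at *
  generalize (lam * a / 2) ^ n = t
  field_simp
  linear_combination t * h₁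

theorem hyp2F1_coeff (p q s : ℂ) (n : ℕ) : PowerSeries.coeff n (hyp2F1 p q s) =
    (n.factorial : ℂ)⁻¹ * (∏ j ∈ Finset.range n, (p + j)) * (∏ j ∈ Finset.range n, (q + j)) *
      (∏ j ∈ Finset.range n, (s + j))⁻¹ := by
  rw [hyp2F1, PowerSeries.coeff_mk, ordinaryHypergeometricCoefficient, ascPochhammer_eval_eq_prod,
    ascPochhammer_eval_eq_prod, ascPochhammer_eval_eq_prod]

theorem jacobiN_eq_hyp2F1 (H : Admissible lam kap bet r c) (hbet : bet ≠ 0) :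
    jacobiN a lam kap bet c = PowerSeries.rescale (2 * bet * a / kap)
      (hyp2F1 (c + 1) (c + 1 / bet) (2 * c + 2 / kap)) := by
  ext n
  have h := jacobiF_mul_coeff_cpow (a := a) H.lam_ne H.kap_ne H.inv_sub_inv hbet
    (fun j => ⟨(H.factor_ne j).1, (H.factor_ne j).2.1⟩) n
  rw [coeff_jacobiN, jacobiWeight, mul_assoc, h, PowerSeries.coeff_rescale, hyp2F1_coeff,
    fall_eq_prod]
  ring

theorem jacobiK_eq_hyp2F1 (H : Admissible lam kap bet r c) (hbet : bet ≠ 0) :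
    jacobiK a lam kap bet c = PowerSeries.rescale (2 * bet * a / kap)
      (hyp2F1 c (c - 1 + 1 / bet) (2 * c - 2 + 2 / kap)) := by
  ext n
  rw [PowerSeries.coeff_rescale, hyp2F1_coeff]
  -- For `c = 0` nothing is known about the denominators at index `-1`, but both series are `1`:
  -- each higher coefficient contains a factor `c = 0`.
  rcases H.pred_ne with rfl | hpred
  · cases n with
    | zero => simp [constantCoeff_jacobiK]
    | succ n =>
      rw [coeff_jacobiK_succ, Finset.prod_range_succ' (fun j : ℕ => (0 : ℂ) + j)]
      simp
  · have h := jacobiF_mul_coeff_cpow (a := a) (u := c - 1) H.lam_ne H.kap_ne H.inv_sub_inv hbet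
      (fun j => by
        cases j with
        | zero => simpa using hpred
        | succ j =>
          have h := H.factor_ne j
          rw [show c - 1 + ((j + 1 : ℕ) : ℂ) = c + j by push_cast; ring]
          exact ⟨h.1, h.2.1⟩) n
    rw [jacobiK, diagSeries, PowerSeries.coeff_mk, mul_assoc, h,
      show c + (n : ℂ) - 1 = c - 1 + n by ring, fall_eq_prod, sub_add_cancel,
      show 2 * (c - 1) + 2 / kap = 2 * c - 2 + 2 / kap by ring]
    ring

end Hypergeometric

end Umbral

theorem mainTheorem8 (a lam kap bet r c : ℂ)
    (hlam : lam ≠ 0) (hkap : kap ≠ 0) (hlk : 1 / kap - 1 / lam = 1 / 2)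
    (hbet : bet = r * kap + (1 - r) * lam)
    (hc : ∀ n : ℕ, c + 1 + n ≠ 0)
    (hF : ∀ n : ℕ, 1 + lam * (c + n) ≠ 0 ∧ 1 + kap * (c + n) ≠ 0 ∧ 1 + bet * (c + n) ≠ 0)
    (hF' : c = 0 ∨ (1 + lam * (c - 1) ≠ 0 ∧ 1 + kap * (c - 1) ≠ 0)) :
    -- the dual raising operator of the Jacobi family itself
    ((∀ n : ℕ, 1 + lam * n ≠ 0 ∧ 1 + kap * n ≠ 0 ∧ 1 + bet * n ≠ 0) →
      IsUnit (jacobiG a lam kap bet) ∧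
      Ring.inverse (jacobiG a lam kap bet) * mulX * jacobiG a lam kap bet =
        mulX + diag (fun n => jacobiA a lam kap r n) +
          opD * diag (fun n => jacobiB a lam kap bet r n)) ∧
    -- the Gamma quotient form of the sequence
    (bet ≠ 0 → ∀ n : ℕ, jacobiF lam kap bet c n =
      (4 * bet / (lam * kap)) ^ n *
        (Complex.Gamma (2 * c + 2 / lam) / Complex.Gamma (2 * (n + c) + 2 / lam)) *
        (Complex.Gamma (n + c + 1 / bet) / Complex.Gamma (c + 1 / bet))) ∧
    -- the explicit operator generates the associated Jacobi polynomials
    IsUnit (assocJacobiG a lam kap bet c) ∧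
    Ring.inverse (assocJacobiG a lam kap bet c) * mulX * assocJacobiG a lam kap bet c =
      assocDualRaising (jacobiA a lam kap r) (jacobiB a lam kap bet r) c ∧
    (∀ n : ℕ, (assocJacobiG a lam kap bet c (Polynomial.X ^ n)).Monic ∧
      (assocJacobiG a lam kap bet c (Polynomial.X ^ n)).natDegree = n ∧
      assocJacobiG a lam kap bet c (Polynomial.X ^ n) =
        assocPoly (jacobiA a lam kap r) (jacobiB a lam kap bet r) c n) ∧
    (∀ m n : ℕ, pairing (momentSeries (assocJacobiG a lam kap bet c))
      (assocJacobiG a lam kap bet c (Polynomial.X ^ m))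
      (assocJacobiG a lam kap bet c (Polynomial.X ^ n)) =
        if m = n then ∏ j ∈ Finset.range n, (j + 1 + c) * jacobiB a lam kap bet r (j + 1 + c)
        else 0) ∧
    -- the Laplace transform of the moment generating function
    diagSeries (fun n => (n.factorial : ℂ)) (momentSeries (assocJacobiG a lam kap bet c)) =
      jacobiN a lam kap bet c * (jacobiK a lam kap bet c)⁻¹ ∧
    (bet ≠ 0 →
      diagSeries (fun n => (n.factorial : ℂ)) (momentSeries (assocJacobiG a lam kap bet c)) =
        PowerSeries.rescale (2 * bet * a / kap)
            (hyp2F1 (c + 1) (c + 1 / bet) (2 * c + 2 / kap)) *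
          (PowerSeries.rescale (2 * bet * a / kap)
            (hyp2F1 c (c - 1 + 1 / bet) (2 * c - 2 + 2 / kap)))⁻¹) := by
  have H : Admissible lam kap bet r c := ⟨hlam, hkap, hlk, hbet, hc, hF, hF'⟩
  refine ⟨fun h => ?_, fun hb => jacobiF_eq_Gamma H hb, isUnit_assocJacobiG H,
    inverse_mul_mulX_mul_assocJacobiG H, fun n => ?_, pairing_assocJacobiG H,
    laplace_momentSeries H, fun hb => ?_⟩
  -- The first claim is the associated statement at `c = 0`, under its own nonvanishing hypotheses;
  -- the condition at index `-1` holds by its first alternative.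
  · have H₀ : Admissible lam kap bet r 0 :=
      ⟨hlam, hkap, hlk, hbet, fun n => by rw [zero_add, add_comm]; exact_mod_cast n.succ_ne_zero,
        by simpa using h, Or.inl rfl⟩
    rw [jacobiG_eq H₀, ← assocDualRaising_zero]
    exact ⟨isUnit_assocJacobiG H₀, inverse_mul_mulX_mul_assocJacobiG H₀⟩
  · rw [assocJacobiG_X_pow H]
    exact ⟨(assocPoly_monic _ _ _ n).1, (assocPoly_monic _ _ _ n).2, rfl⟩
  · rw [laplace_momentSeries H, jacobiN_eq_hyp2F1 H hb, jacobiK_eq_hyp2F1 H hb]
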